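/- Let $k$ be a field. Let $\mathrm{BiAlg}$ be the category of $k$-bialgebras and bialgebra maps, let $\mathrm{HopfAlg}$ be its full subcategory of Hopf algebras, and let $\mathrm{SHopfAlg}$ be the full subcategory of $\mathrm{HopfAlg}$ consisting of the Hopf algebras with bijective antipode. Let $j:\mathrm{HopfAlg}\to\mathrm{BiAlg}$ and $i:\mathrm{SHopfAlg}\to\mathrm{HopfAlg}$ denote the inclusion functors. (a) The functor $j$ has a left adjoint $H^*$ and a right adjoint $H_*$. For every bialgebra $B$, the component $B\to jH^*(B)$ of the unit of the adjunction $H^*\dashv j$ is an epimorphism in $\mathrm{BiAlg}$, and the component $jH_*(B)\to B$ of the counit of the adjunction $j\dashv H_*$ is a monomorphism in $\mathrm{BiAlg}$. (b) The functor $i$ has a left adjoint $K^*$ and a right adjoint $K_*$. For every Hopf algebra $H$, the component $H\to iK^*(H)$ of the unit of the adjunction $K^*\dashv i$ is an epimorphism in $\mathrm{HopfAlg}$, and the component $iK_*(H)\to H$ of the counit of the adjunction $i\dashv K_*$ is a monomorphism in $\mathrm{HopfAlg}$. (These statements hold for any choice of the adjoint functors and adjunctions.) -/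

import Mathlib

open CategoryTheory

universe w u v

/-- The inclusion functor `j : HopfAlg ⥤ BiAlg` over a field `k`. A morphism of Hopf algebras is
a morphism of the underlying bialgebras. -/
abbrev hopfToBialg (k : Type u) [Field k] : HopfAlgCat.{w} k ⥤ BialgCat.{w} k :=
  forget₂ (HopfAlgCat.{w} k) (BialgCat.{w} k)

/-- The property of a Hopf algebra that its antipode is bijective. -/
def hasBijectiveAntipode (k : Type u) [Field k] : ObjectProperty (HopfAlgCat.{w} k) :=
  fun H => Function.Bijective (HopfAlgebra.antipode k (A := H))

/-- The category `SHopfAlg` of Hopf algebras with bijective antipode, as a full subcategory of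
the category of Hopf algebras. -/
abbrev SHopfAlgCat (k : Type u) [Field k] : Type (max u (w + 1)) :=
  (hasBijectiveAntipode.{w} k).FullSubcategory

/-- The inclusion functor `i : SHopfAlg ⥤ HopfAlg`. -/
abbrev sHopfToHopf (k : Type u) [Field k] : SHopfAlgCat.{w} k ⥤ HopfAlgCat.{w} k :=
  (hasBijectiveAntipode.{w} k).ι

/-! Left adjoints. A bialgebra map `f` from `B` to a Hopf algebra brings with it `S ∘ f`, `S² ∘ f`,
`S³ ∘ f`, ..., alternately homomorphisms and anti-homomorphisms, each the convolution inverse of its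
predecessor, with the multiplication reversed at every other stage. The free object is the algebra
generated by a universal such tower (`TowerAlgebra`), indexed by `ℕ`, or by `ℤ` if the antipode has
to be bijective. Tensor products and shifts of towers are towers; this gives the comultiplication
and the antipode. Since convolution inverses are unique, an algebra map out of the tower algebra is
determined on the base copy of `B` (`TowerAlgebra.hom_ext`), so the unit is an epimorphism.

Right adjoints. Every countable subset of a Hopf algebra over a field lies in a Hopf subalgebra of
countable dimension. Up to isomorphism, the Hopf algebras of countable dimension over `B` form a
set, and their colimit (`CofreeHopf`) is terminal among all Hopf algebras over `B`, because each of
these is the directed union of countable-dimensional pieces. A proposition `p` records whether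
antipodes are required to be bijective.

That the counit is a monomorphism then follows formally from the unit being an epimorphism
(`mono_counit_of_epi_unit`). -/

open scoped TensorProduct
open Coalgebra

/-! ### Algebras presented by all relations valid in a class of assignments -/

section PresentedAlgebra

variable {k : Type u} [CommRing k] {X : Type w}

/-- The relation on a free algebra identifying two elements that have the same value under every
admissible assignment of the generators. -/
def PresentedAlgebra.Rel
    (Good : ∀ (R : Type (max u w)) [Ring R] [Algebra k R], (X → R) → Prop)
    (p q : FreeAlgebra k X) : Prop :=
  ∀ (R : Type (max u w)) [Ring R] [Algebra k R] (φ : X → R), Good R φ →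
    FreeAlgebra.lift k φ p = FreeAlgebra.lift k φ q

/-- The algebra generated by `X` subject to all the relations that hold for every assignment of
the generators that satisfies the predicate `Good`. -/
def PresentedAlgebra
    (Good : ∀ (R : Type (max u w)) [Ring R] [Algebra k R], (X → R) → Prop) : Type (max u w) :=
  RingQuot (PresentedAlgebra.Rel Good)

namespace PresentedAlgebra

variable (Good : ∀ (R : Type (max u w)) [Ring R] [Algebra k R], (X → R) → Prop)

noncomputable instance : Ring (PresentedAlgebra Good) :=
  inferInstanceAs (Ring (RingQuot (Rel Good)))

noncomputable instance : Algebra k (PresentedAlgebra Good) :=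
  inferInstanceAs (Algebra k (RingQuot (Rel Good)))

/-- The quotient map from the free algebra. -/
noncomputable def mk : FreeAlgebra k X →ₐ[k] PresentedAlgebra Good :=
  RingQuot.mkAlgHom k (Rel Good)

/-- The canonical generators. -/
noncomputable def gen (x : X) : PresentedAlgebra Good :=
  mk Good (FreeAlgebra.ι k x)

variable {Good}

theorem lift_gen_eq_mk : FreeAlgebra.lift k (gen Good) = mk Good := by
  ext x; simp [gen]

/-- This replaces an explicit list of relations: an identity between the generators is proved by
checking it for every admissible assignment. -/
theorem lift_gen_eq_of_forall {p q : FreeAlgebra k X}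
    (h : ∀ (R : Type (max u w)) [Ring R] [Algebra k R] (φ : X → R), Good R φ →
      FreeAlgebra.lift k φ p = FreeAlgebra.lift k φ q) :
    FreeAlgebra.lift k (gen Good) p = FreeAlgebra.lift k (gen Good) q := by
  rw [lift_gen_eq_mk]
  exact RingQuot.mkAlgHom_rel k h

/-- The homomorphism determined by an admissible assignment of the generators. -/
noncomputable def lift {R : Type (max u w)} [Ring R] [Algebra k R] (φ : X → R) (h : Good R φ) :
    PresentedAlgebra Good →ₐ[k] R :=
  RingQuot.liftAlgHom k ⟨FreeAlgebra.lift k φ, fun _ _ hr => hr R φ h⟩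

@[simp]
theorem lift_gen {R : Type (max u w)} [Ring R] [Algebra k R] (φ : X → R) (h : Good R φ) (x : X) :
    lift φ h (gen Good x) = φ x := by
  simp only [lift, gen, mk]
  erw [RingQuot.liftAlgHom_mkAlgHom_apply]
  simp

theorem algHom_ext {R : Type*} [Semiring R] [Algebra k R] {f g : PresentedAlgebra Good →ₐ[k] R}
    (h : ∀ x, f (gen Good x) = g (gen Good x)) : f = g := by
  apply RingQuot.ringQuot_ext'
  ext x
  exact h x

theorem adjoin_range_gen : Algebra.adjoin k (Set.range (gen Good)) = ⊤ := by
  have : Set.range (gen Good) = mk Good '' Set.range (FreeAlgebra.ι k) := by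
    rw [← Set.range_comp]; rfl
  rw [this, ← AlgHom.map_adjoin, FreeAlgebra.adjoin_range_ι, Algebra.map_top]
  exact (AlgHom.range_eq_top _).2 (RingQuot.mkAlgHom_surjective k _)

end PresentedAlgebra

end PresentedAlgebra

/-! ### Convolution inverses of algebra homomorphisms -/

section ConvInverse

open WithConv MulOpposite

variable {k : Type*} [CommRing k] {B : Type*} [Ring B] [Bialgebra k B]

/-- The linear map underlying an anti-homomorphism. -/
def AlgHom.unopLinearMap {R : Type*} [Ring R] [Algebra k R] (g : B →ₐ[k] Rᵐᵒᵖ) : B →ₗ[k] R :=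
  (opLinearEquiv k).symm.toLinearMap ∘ₗ g.toLinearMap

@[simp]
theorem AlgHom.unopLinearMap_apply {R : Type*} [Ring R] [Algebra k R] (g : B →ₐ[k] Rᵐᵒᵖ) (b : B) :
    g.unopLinearMap b = MulOpposite.unop (g b) := rfl

/-- The homomorphism `f` and the anti-homomorphism `g` are inverse to each other for the
convolution product. -/
structure IsConvInverse {R : Type*} [Ring R] [Algebra k R] (f : B →ₐ[k] R) (g : B →ₐ[k] Rᵐᵒᵖ) :
    Prop where
  mul_unop : toConv f.toLinearMap * toConv g.unopLinearMap = 1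
  unop_mul : toConv g.unopLinearMap * toConv f.toLinearMap = 1

namespace IsConvInverse

variable {R : Type*} [Ring R] [Algebra k R] {f f' : B →ₐ[k] R} {g g' : B →ₐ[k] Rᵐᵒᵖ}

theorem sum_mul_unop (h : IsConvInverse f g) {b : B} {ι : Type*} (r : Repr k b ι) :
    ∑ i ∈ r.index, f (r.left i) * unop (g (r.right i)) = algebraMap k R (counit b) := by
  have := congr($(h.mul_unop) b)
  rw [r.convMul_apply] at this
  simpa using this

theorem sum_unop_mul (h : IsConvInverse f g) {b : B} {ι : Type*} (r : Repr k b ι) :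
    ∑ i ∈ r.index, unop (g (r.left i)) * f (r.right i) = algebraMap k R (counit b) := by
  have := congr($(h.unop_mul) b)
  rw [r.convMul_apply] at this
  simpa using this

theorem of_sum
    (h₁ : ∀ b : B, ∑ i ∈ (ℛ k b).index, f ((ℛ k b).left i) * unop (g ((ℛ k b).right i)) =
      algebraMap k R (counit b))
    (h₂ : ∀ b : B, ∑ i ∈ (ℛ k b).index, unop (g ((ℛ k b).left i)) * f ((ℛ k b).right i) =
      algebraMap k R (counit b)) : IsConvInverse f g where
  mul_unop := by
    ext b
    rw [(ℛ k b).convMul_apply]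
    simpa using h₁ b
  unop_mul := by
    ext b
    rw [(ℛ k b).convMul_apply]
    simpa using h₂ b

/-- Two-sided inverses in the convolution monoid are unique. With `left_unique`, this is the source
of every uniqueness statement about towers and antipodes. -/
theorem right_unique (h : IsConvInverse f g) (h' : IsConvInverse f g') : g = g' := by
  have := left_inv_eq_right_inv h.unop_mul h'.mul_unop
  ext b
  exact congr(op ($this b))

theorem left_unique (h : IsConvInverse f g) (h' : IsConvInverse f' g) : f = f' := by
  have := left_inv_eq_right_inv h.mul_unop h'.unop_mul
  ext b
  exact congr($this b)

theorem map {R' : Type*} [Ring R'] [Algebra k R'] (h : IsConvInverse f g) (φ : R →ₐ[k] R') :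
    IsConvInverse (φ.comp f) ((AlgHom.op φ).comp g) :=
  of_sum
    (fun b => by simpa using congr(φ $(h.sum_mul_unop (ℛ k b))))
    (fun b => by simpa using congr(φ $(h.sum_unop_mul (ℛ k b))))

theorem precomp {C : Type*} [Ring C] [Bialgebra k C] (h : IsConvInverse f g) (φ : C →ₐc[k] B) :
    IsConvInverse (f.comp (φ : C →ₐ[k] B)) (g.comp (φ : C →ₐ[k] B)) :=
  of_sum
    (fun c => by simpa using h.sum_mul_unop ((ℛ k c).induced φ))
    (fun c => by simpa using h.sum_unop_mul ((ℛ k c).induced φ))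

theorem opOp (h : IsConvInverse f g) :
    IsConvInverse ((AlgEquiv.opOp k R).toAlgHom.comp f)
      ((AlgEquiv.opOp k Rᵐᵒᵖ).toAlgHom.comp g) :=
  h.map (AlgEquiv.opOp k R).toAlgHom

variable (k B) in
theorem counit : IsConvInverse (Bialgebra.counitAlgHom k B)
    ((AlgEquiv.toOpposite k k).toAlgHom.comp (Bialgebra.counitAlgHom k B)) := by
  have key (b : B) : ∑ i ∈ (ℛ k b).index, Coalgebra.counit (R := k) ((ℛ k b).left i) *
      Coalgebra.counit (R := k) ((ℛ k b).right i) = Coalgebra.counit (R := k) b := by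
    simpa using congr(Coalgebra.counit (R := k) $(sum_counit_smul (ℛ k b)))
  exact of_sum (fun b => by simpa using key b) (fun b => by simpa using key b)

/-- Convolution products of two homomorphisms with commuting images. -/
theorem mul {F : B →ₐ[k] R} {G : B →ₐ[k] Rᵐᵒᵖ} (h : IsConvInverse f g) (h' : IsConvInverse f' g')
    (hF : toConv F.toLinearMap = toConv f.toLinearMap * toConv f'.toLinearMap)
    (hG : toConv G.unopLinearMap = toConv g'.unopLinearMap * toConv g.unopLinearMap) :
    IsConvInverse F G where
  mul_unop := by
    rw [hF, hG, mul_assoc, ← mul_assoc (toConv f'.toLinearMap), h'.mul_unop, one_mul, h.mul_unop]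
  unop_mul := by
    rw [hF, hG, mul_assoc, ← mul_assoc (toConv g.unopLinearMap), h.unop_mul, one_mul, h'.unop_mul]

variable {R' : Type*} [Ring R'] [Algebra k R'] {p : B →ₐ[k] R'} {q : B →ₐ[k] R'ᵐᵒᵖ}

variable (k B) in
/-- The opposite comultiplication of a bialgebra. -/
noncomputable def _root_.Bialgebra.comulOpAlgHom : B →ₐ[k] B ⊗[k] B :=
  (Algebra.TensorProduct.comm k B B).toAlgHom.comp (Bialgebra.comulAlgHom k B)

/-- The map `(f ⊗ p) ∘ Δ` is the convolution product of `f ⊗ 1` and `1 ⊗ p`. Inverting reverses the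
order of the factors, which is why the opposite comultiplication appears. -/
theorem tensor (h : IsConvInverse f g) (h' : IsConvInverse p q) :
    IsConvInverse ((Algebra.TensorProduct.map f p).comp (Bialgebra.comulAlgHom k B))
      ((Algebra.TensorProduct.opAlgEquiv k k R R').toAlgHom.comp
        ((Algebra.TensorProduct.map g q).comp (Bialgebra.comulOpAlgHom k B))) := by
  refine mul (h.map (Algebra.TensorProduct.includeLeft (S := k) (B := R')))
    (h'.map (Algebra.TensorProduct.includeRight (A := R))) ?_ ?_
  · ext b
    rw [(ℛ k b).convMul_apply]
    simp [← (ℛ k b).eq]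
  · ext b
    rw [(ℛ k b).convMul_apply]
    simp [← (ℛ k b).eq, Bialgebra.comulOpAlgHom]

theorem tensorOp (h : IsConvInverse f g) (h' : IsConvInverse p q) :
    IsConvInverse ((Algebra.TensorProduct.map f p).comp (Bialgebra.comulOpAlgHom k B))
      ((Algebra.TensorProduct.opAlgEquiv k k R R').toAlgHom.comp
        ((Algebra.TensorProduct.map g q).comp (Bialgebra.comulAlgHom k B))) := by
  refine mul (h'.map (Algebra.TensorProduct.includeRight (A := R)))
    (h.map (Algebra.TensorProduct.includeLeft (S := k) (B := R'))) ?_ ?_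
  · ext b
    rw [(ℛ k b).convMul_apply]
    simp [← (ℛ k b).eq, Bialgebra.comulOpAlgHom]
  · ext b
    rw [(ℛ k b).convMul_apply]
    simp [← (ℛ k b).eq]

end IsConvInverse

theorem HopfAlgebra.isConvInverse_antipode {L : Type*} [Ring L] [HopfAlgebra k L] :
    IsConvInverse (AlgHom.id k L) (HopfAlgebra.antipodeAlgHomOp k L) :=
  .of_sum
    (fun b => by simpa using HopfAlgebra.sum_mul_antipode_eq_algebraMap_counit (ℛ k b))
    (fun b => by simpa using HopfAlgebra.sum_antipode_mul_eq_algebraMap_counit (ℛ k b))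

/-- Both `φ ∘ S` and `S ∘ φ` are convolution inverses of `φ`. -/
theorem BialgHom.map_antipode {L M : Type*} [Ring L] [HopfAlgebra k L] [Ring M] [HopfAlgebra k M]
    (φ : L →ₐc[k] M) (a : L) :
    φ (HopfAlgebra.antipode k a) = HopfAlgebra.antipode k (φ a) := by
  have h₁ := (HopfAlgebra.isConvInverse_antipode (k := k) (L := L)).map (φ : L →ₐ[k] M)
  have h₂ := (HopfAlgebra.isConvInverse_antipode (k := k) (L := M)).precomp φ
  have := congr(unop ($(h₁.right_unique h₂) a))
  simpa using this

/-- The elements on which a homomorphism and an anti-homomorphism are inverse to each other for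
the convolution product form a subalgebra. -/
theorem IsConvInverse.of_adjoin_eq_top {R : Type*} [Ring R] [Algebra k R] {f : B →ₐ[k] R}
    {g : B →ₐ[k] Rᵐᵒᵖ} {s : Set B} (hs : Algebra.adjoin k s = ⊤)
    (h₁ : ∀ b ∈ s, LinearMap.mul' k R (TensorProduct.map f.toLinearMap g.unopLinearMap (comul b)) =
      algebraMap k R (Coalgebra.counit b))
    (h₂ : ∀ b ∈ s, LinearMap.mul' k R (TensorProduct.map g.unopLinearMap f.toLinearMap (comul b)) =
      algebraMap k R (Coalgebra.counit b)) : IsConvInverse f g := by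
  have key (b : B) : (toConv f.toLinearMap * toConv g.unopLinearMap) b =
      algebraMap k R (Coalgebra.counit b) ∧
      (toConv g.unopLinearMap * toConv f.toLinearMap) b =
      algebraMap k R (Coalgebra.counit b) := by
    have hb : b ∈ Algebra.adjoin k s := hs ▸ Algebra.mem_top
    induction hb using Algebra.adjoin_induction with
    | mem x hx => exact ⟨h₁ x hx, h₂ x hx⟩
    | algebraMap r => simp [Algebra.algebraMap_eq_smul_one, Algebra.TensorProduct.one_def]
    | add x y _ _ hx hy =>
      simp only [map_add] at *
      simp [hx, hy]
    | mul x y _ _ hx hy =>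
      rw [(ℛ k x).convMul_apply, (ℛ k x).convMul_apply] at hx
      rw [(ℛ k y).convMul_apply, (ℛ k y).convMul_apply] at hy
      rw [((ℛ k x).mul (ℛ k y)).convMul_apply, ((ℛ k x).mul (ℛ k y)).convMul_apply]
      obtain ⟨hx₁, hx₂⟩ := hx
      obtain ⟨hy₁, hy₂⟩ := hy
      simp only [AlgHom.toLinearMap_apply, AlgHom.unopLinearMap_apply] at *
      -- In `f(x₁) f(y₁) g(y₂) g(x₂)` the inner sum, over `y`, collapses to a scalar, which is then
      -- moved out. In the other product `g(y₁) g(x₁) f(x₂) f(y₂)` the inner sum is over `x`, hence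
      -- `Finset.sum_product_right` there.
      have c (r : k) (a a' : R) : a * (algebraMap k R r * a') = algebraMap k R r * (a * a') := by
        rw [← mul_assoc, ← Algebra.commutes r a, mul_assoc]
      constructor
      · simp only [Coalgebra.Repr.mul_index, Coalgebra.Repr.mul_left, Coalgebra.Repr.mul_right,
          Finset.sum_product, map_mul, MulOpposite.unop_mul,
          mul_assoc, Bialgebra.counit_mul]
        simp only [← Finset.mul_sum, ← mul_assoc (f ((ℛ k y).left _)), ← Finset.sum_mul, hy₁, c, hx₁]
        rw [← map_mul, mul_comm, map_mul]
      · simp only [Coalgebra.Repr.mul_index, Coalgebra.Repr.mul_left, Coalgebra.Repr.mul_right,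
          Finset.sum_product_right, map_mul, MulOpposite.unop_mul,
          mul_assoc, Bialgebra.counit_mul]
        simp only [← Finset.mul_sum, ← mul_assoc (unop (g ((ℛ k x).left _))), ← Finset.sum_mul,
          hx₂, c, hy₂]
  exact ⟨WithConv.ext (LinearMap.ext fun b => (key b).1),
    WithConv.ext (LinearMap.ext fun b => (key b).2)⟩

end ConvInverse

/-! ### Towers of successive convolution inverses -/

section Tower

open WithConv MulOpposite

/-- A family of homomorphisms and anti-homomorphisms from a bialgebra, each of which is
the convolution inverse of the preceding one. -/
structure AntipodeTower (k : Type*) [CommRing k] {I : Type} (σ : I → I) (B : Type*) [Ring B]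
    [Bialgebra k B] (R : Type*) [Ring R] [Algebra k R] where
  /-- The homomorphisms of the family. -/
  hom : I → B →ₐ[k] R
  /-- The anti-homomorphisms of the family. -/
  antiHom : I → B →ₐ[k] Rᵐᵒᵖ
  hom_antiHom (m : I) : IsConvInverse (hom m) (antiHom m)
  antiHom_hom (m : I) :
    IsConvInverse (antiHom m) ((AlgEquiv.opOp k R).toAlgHom.comp (hom (σ m)))

namespace AntipodeTower

variable {k : Type*} [CommRing k] {I : Type} {σ : I → I} {B : Type*} [Ring B] [Bialgebra k B]
  {R : Type*} [Ring R] [Algebra k R]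

/-- The image of a tower under a homomorphism. -/
@[simps]
def map {R' : Type*} [Ring R'] [Algebra k R'] (t : AntipodeTower k σ B R) (φ : R →ₐ[k] R') :
    AntipodeTower k σ B R' where
  hom m := φ.comp (t.hom m)
  antiHom m := (AlgHom.op φ).comp (t.antiHom m)
  hom_antiHom m := (t.hom_antiHom m).map φ
  antiHom_hom m := (t.antiHom_hom m).map (AlgHom.op φ)

/-- The tower consisting of the counits. -/
@[simps]
noncomputable def counit : AntipodeTower k σ B k where
  hom _ := Bialgebra.counitAlgHom k B
  antiHom _ := (AlgEquiv.toOpposite k k).toAlgHom.comp (Bialgebra.counitAlgHom k B)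
  hom_antiHom _ := .counit k B
  antiHom_hom _ := (IsConvInverse.counit k B).map (AlgEquiv.toOpposite k k).toAlgHom

/-- The tensor product of two towers. -/
@[simps]
noncomputable def tensor {R' : Type*} [Ring R'] [Algebra k R'] (t : AntipodeTower k σ B R)
    (t' : AntipodeTower k σ B R') : AntipodeTower k σ B (R ⊗[k] R') where
  hom m := (Algebra.TensorProduct.map (t.hom m) (t'.hom m)).comp (Bialgebra.comulAlgHom k B)
  antiHom m := (Algebra.TensorProduct.opAlgEquiv k k R R').toAlgHom.comp
    ((Algebra.TensorProduct.map (t.antiHom m) (t'.antiHom m)).comp (Bialgebra.comulOpAlgHom k B))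
  hom_antiHom m := (t.hom_antiHom m).tensor (t'.hom_antiHom m)
  antiHom_hom m := by
    -- The anti-homomorphisms already use the opposite comultiplication, so inverting them brings
    -- back the original one, up to identifying the double opposite.
    convert ((t.antiHom_hom m).tensorOp (t'.antiHom_hom m)).map
      (Algebra.TensorProduct.opAlgEquiv k k R R').toAlgHom using 1
    ext b
    simp [← (ℛ k b).eq]

/-- Shifting a tower by one place. -/
@[simps]
def shift (t : AntipodeTower k σ B R) : AntipodeTower k σ B Rᵐᵒᵖ where
  hom := t.antiHom
  antiHom m := (AlgEquiv.opOp k R).toAlgHom.comp (t.hom (σ m))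
  hom_antiHom := t.antiHom_hom
  antiHom_hom m := (t.hom_antiHom (σ m)).opOp

/-- Shifting a tower by one place in the other direction. -/
@[simps]
def unshift (t : AntipodeTower k σ B R) (τ : I → I) (h : ∀ m, σ (τ m) = m) (h' : ∀ m, τ (σ m) = m) :
    AntipodeTower k σ B Rᵐᵒᵖ where
  hom m := t.antiHom (τ m)
  antiHom m := (AlgEquiv.opOp k R).toAlgHom.comp (t.hom m)
  hom_antiHom m := by simpa only [h] using t.antiHom_hom (τ m)
  antiHom_hom m := by simpa only [h'] using (t.hom_antiHom m).opOp

/-- An index set is generated by an element if it is the only subset that contains that element and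
is closed under `σ` and its inverse. -/
def Generates (σ : I → I) (o : I) : Prop :=
  ∀ P : I → Prop, P o → (∀ m, P m ↔ P (σ m)) → ∀ m, P m

/-- Uniqueness of inverses propagates equality from `hom m` through `antiHom m` to `hom (σ m)` and
back, hence from `o` to every index. -/
theorem eq_of_hom_eq {o : I} (ho : Generates σ o) {t t' : AntipodeTower k σ B R}
    (h : t.hom o = t'.hom o) : t.hom = t'.hom ∧ t.antiHom = t'.antiHom := by
  have key : ∀ m, t.hom m = t'.hom m := by
    refine ho _ h fun m => ⟨fun hm => ?_, fun hm => ?_⟩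
    · have h₁ := t.hom_antiHom m
      rw [hm] at h₁
      have h₂ := t.antiHom_hom m
      rw [h₁.right_unique (t'.hom_antiHom m)] at h₂
      have h₃ := h₂.right_unique (t'.antiHom_hom m)
      ext b
      simpa using congr(unop (unop ($h₃ b)))
    · have h₁ := t.antiHom_hom m
      rw [hm] at h₁
      have h₂ := t.hom_antiHom m
      rw [h₁.left_unique (t'.antiHom_hom m)] at h₂
      exact h₂.left_unique (t'.hom_antiHom m)
  refine ⟨funext key, funext fun m => ?_⟩
  have := t.hom_antiHom m
  rw [key m] at this
  exact this.right_unique (t'.hom_antiHom m)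

/-- The values of a tower, as a function on a type of symbols. -/
def eval (t : AntipodeTower k σ B R) : (I × B) ⊕ (I × B) → R :=
  Sum.elim (fun x => t.hom x.1 x.2) (fun x => unop (t.antiHom x.1 x.2))

end AntipodeTower

/-! ### The algebra generated by a universal tower -/

section
variable {k : Type u} [CommRing k] {I : Type} (σ : I → I) (B : Type w) [Ring B] [Bialgebra k B]

/-- An assignment of values to symbols that comes from a tower. -/
def IsTowerEval (R : Type (max u w)) [Ring R] [Algebra k R]
    (φ : (I × B) ⊕ (I × B) → R) : Prop :=
  ∃ t : AntipodeTower k σ B R, φ = t.eval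

variable (k)

/-- The algebra with a universal tower of homomorphisms and anti-homomorphisms from a given
bialgebra. -/
abbrev TowerAlgebra : Type (max u w) :=
  PresentedAlgebra (k := k) (IsTowerEval (k := k) σ B)

end

namespace TowerAlgebra

open PresentedAlgebra

variable {k : Type u} [CommRing k] {I : Type} {σ : I → I} {B : Type w} [Ring B] [Bialgebra k B]

/-- The generators of the first kind. -/
noncomputable def x (m : I) (b : B) : TowerAlgebra k σ B := gen _ (.inl (m, b))

/-- The generators of the second kind. -/
noncomputable def y (m : I) (b : B) : TowerAlgebra k σ B := gen _ (.inr (m, b))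

theorem lift_eq_of_forall {p q : FreeAlgebra k ((I × B) ⊕ (I × B))}
    (h : ∀ (R : Type (max u w)) [Ring R] [Algebra k R] (t : AntipodeTower k σ B R),
      FreeAlgebra.lift k t.eval p = FreeAlgebra.lift k t.eval q) :
    FreeAlgebra.lift k (gen (IsTowerEval (k := k) σ B)) p =
      FreeAlgebra.lift k (gen (IsTowerEval (k := k) σ B)) q :=
  lift_gen_eq_of_forall fun R _ _ φ hφ => by
    obtain ⟨t, rfl⟩ := hφ
    exact h R t

open FreeAlgebra in
/-- The homomorphisms of the universal tower. -/
noncomputable def xHom (m : I) : B →ₐ[k] TowerAlgebra k σ B where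
  toFun := x m
  map_one' := by
    have := lift_eq_of_forall (σ := σ) (B := B) (p := ι k (.inl (m, 1))) (q := 1)
      fun R _ _ t => by simp [AntipodeTower.eval]
    simpa [x, y] using this
  map_mul' a b := by
    have := lift_eq_of_forall (σ := σ) (B := B) (p := ι k (.inl (m, a * b)))
      (q := ι k (.inl (m, a)) * ι k (.inl (m, b)))
      fun R _ _ t => by simp [AntipodeTower.eval]
    simpa [x, y] using this
  map_zero' := by
    have := lift_eq_of_forall (σ := σ) (B := B) (p := ι k (.inl (m, 0))) (q := 0)
      fun R _ _ t => by simp [AntipodeTower.eval]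
    simpa [x, y] using this
  map_add' a b := by
    have := lift_eq_of_forall (σ := σ) (B := B) (p := ι k (.inl (m, a + b)))
      (q := ι k (.inl (m, a)) + ι k (.inl (m, b)))
      fun R _ _ t => by simp [AntipodeTower.eval]
    simpa [x, y] using this
  commutes' r := by
    have := lift_eq_of_forall (σ := σ) (B := B) (p := ι k (.inl (m, algebraMap k B r)))
      (q := algebraMap k _ r)
      fun R _ _ t => by simp [AntipodeTower.eval]
    simpa [x, y] using this

open FreeAlgebra in
/-- The anti-homomorphisms of the universal tower. -/
noncomputable def yHom (m : I) : B →ₐ[k] (TowerAlgebra k σ B)ᵐᵒᵖ where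
  toFun b := op (y m b)
  map_one' := unop_injective <| by
    have := lift_eq_of_forall (σ := σ) (B := B) (p := ι k (.inr (m, 1))) (q := 1)
      fun R _ _ t => by simp [AntipodeTower.eval]
    simpa [x, y] using this
  map_mul' a b := unop_injective <| by
    have := lift_eq_of_forall (σ := σ) (B := B) (p := ι k (.inr (m, a * b)))
      (q := ι k (.inr (m, b)) * ι k (.inr (m, a)))
      fun R _ _ t => by simp [AntipodeTower.eval]
    simpa [x, y] using this
  map_zero' := unop_injective <| by
    have := lift_eq_of_forall (σ := σ) (B := B) (p := ι k (.inr (m, 0))) (q := 0)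
      fun R _ _ t => by simp [AntipodeTower.eval]
    simpa [x, y] using this
  map_add' a b := unop_injective <| by
    have := lift_eq_of_forall (σ := σ) (B := B) (p := ι k (.inr (m, a + b)))
      (q := ι k (.inr (m, a)) + ι k (.inr (m, b)))
      fun R _ _ t => by simp [AntipodeTower.eval]
    simpa [x, y] using this
  commutes' r := unop_injective <| by
    have := lift_eq_of_forall (σ := σ) (B := B) (p := ι k (.inr (m, algebraMap k B r)))
      (q := algebraMap k _ r)
      fun R _ _ t => by simp [AntipodeTower.eval]
    simpa [x, y] using this

@[simp] theorem xHom_apply (m : I) (b : B) : xHom (k := k) (σ := σ) m b = x m b := rfl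

@[simp] theorem yHom_apply (m : I) (b : B) : yHom (k := k) (σ := σ) m b = op (y m b) := rfl

variable (k σ B) in
open FreeAlgebra in
/-- The universal tower. -/
@[simps]
noncomputable def univ : AntipodeTower k σ B (TowerAlgebra k σ B) where
  hom := xHom
  antiHom := yHom
  hom_antiHom m := .of_sum
    (fun b => by
      have := lift_eq_of_forall (σ := σ) (B := B)
        (p := ∑ i ∈ (ℛ k b).index, ι k (.inl (m, (ℛ k b).left i)) * ι k (.inr (m, (ℛ k b).right i)))
        (q := algebraMap k _ (Coalgebra.counit b))
        fun R _ _ t => by simpa [AntipodeTower.eval] using (t.hom_antiHom m).sum_mul_unop (ℛ k b)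
      simpa [x, y] using this)
    (fun b => by
      have := lift_eq_of_forall (σ := σ) (B := B)
        (p := ∑ i ∈ (ℛ k b).index, ι k (.inr (m, (ℛ k b).left i)) * ι k (.inl (m, (ℛ k b).right i)))
        (q := algebraMap k _ (Coalgebra.counit b))
        fun R _ _ t => by simpa [AntipodeTower.eval] using (t.hom_antiHom m).sum_unop_mul (ℛ k b)
      simpa [x, y] using this)
  antiHom_hom m := .of_sum
    -- The relation lives in the opposite algebra, so the factors appear in reversed order, with the
    -- right tensor leg first.
    (fun b => unop_injective <| by
      have := lift_eq_of_forall (σ := σ) (B := B)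
        (p := ∑ i ∈ (ℛ k b).index,
          ι k (.inl (σ m, (ℛ k b).right i)) * ι k (.inr (m, (ℛ k b).left i)))
        (q := algebraMap k _ (Coalgebra.counit b))
        fun R _ _ t => by
          simpa [AntipodeTower.eval] using congr(unop $((t.antiHom_hom m).sum_mul_unop (ℛ k b)))
      simpa [x, y] using this)
    (fun b => unop_injective <| by
      have := lift_eq_of_forall (σ := σ) (B := B)
        (p := ∑ i ∈ (ℛ k b).index,
          ι k (.inr (m, (ℛ k b).right i)) * ι k (.inl (σ m, (ℛ k b).left i)))
        (q := algebraMap k _ (Coalgebra.counit b))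
        fun R _ _ t => by
          simpa [AntipodeTower.eval] using congr(unop $((t.antiHom_hom m).sum_unop_mul (ℛ k b)))
      simpa [x, y] using this)

/-- The homomorphism determined by a tower. -/
noncomputable def lift {R : Type (max u w)} [Ring R] [Algebra k R] (t : AntipodeTower k σ B R) :
    TowerAlgebra k σ B →ₐ[k] R :=
  PresentedAlgebra.lift t.eval ⟨t, rfl⟩

@[simp]
theorem lift_x {R : Type (max u w)} [Ring R] [Algebra k R] (t : AntipodeTower k σ B R) (m : I)
    (b : B) : lift t (x m b) = t.hom m b :=
  lift_gen _ _ _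

@[simp]
theorem lift_y {R : Type (max u w)} [Ring R] [Algebra k R] (t : AntipodeTower k σ B R) (m : I)
    (b : B) : lift t (y m b) = unop (t.antiHom m b) :=
  lift_gen _ _ _

/-- The images of the universal tower under `f` and `g` agree at `o`, hence everywhere. This makes
the unit an epimorphism and reduces the bialgebra axioms to the base copy of `B`. -/
theorem hom_ext {o : I} (ho : AntipodeTower.Generates σ o) {R : Type*} [Ring R] [Algebra k R]
    {f g : TowerAlgebra k σ B →ₐ[k] R} (h : ∀ b, f (x o b) = g (x o b)) : f = g := by
  have := AntipodeTower.eq_of_hom_eq ho (t := (univ k σ B).map f) (t' := (univ k σ B).map g)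
    (AlgHom.ext h)
  refine PresentedAlgebra.algHom_ext ?_
  rintro (⟨m, b⟩ | ⟨m, b⟩)
  · exact congr($(this.1) m b)
  · exact congr(unop ($(this.2) m b))

end TowerAlgebra
end Tower

/-! ### Hopf structure and universal property of the tower algebra -/

section HopfStructure

open WithConv MulOpposite

/-- A self-map of a set together with an element that generates the set under the map and
its inverse. -/
class AntipodeTower.Based {I : Type} (σ : I → I) where
  /-- The generating element. -/
  base : I
  generates : AntipodeTower.Generates σ base

/-- A bialgebra with an anti-endomorphism that is the convolution inverse of the identity
is a Hopf algebra. -/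
noncomputable abbrev HopfAlgebra.ofIsConvInverse {k : Type*} [CommRing k] {A : Type*} [Ring A]
    [Bialgebra k A] (S : A →ₐ[k] Aᵐᵒᵖ) (h : IsConvInverse (AlgHom.id k A) S) : HopfAlgebra k A :=
  .ofConvInverse S.unopLinearMap h.unop_mul h.mul_unop

namespace TowerAlgebra

open PresentedAlgebra AntipodeTower

variable {k : Type u} [CommRing k] {I : Type} {σ : I → I} {B : Type w} [Ring B] [Bialgebra k B]

/-- The comultiplication of the universal algebra. -/
noncomputable def comulHom : TowerAlgebra k σ B →ₐ[k] TowerAlgebra k σ B ⊗[k] TowerAlgebra k σ B :=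
  lift ((univ k σ B).tensor (univ k σ B))

/-- The counit of the universal algebra. -/
noncomputable def counitHom : TowerAlgebra k σ B →ₐ[k] k :=
  -- The universal property only reaches algebras in `Type (max u w)`, so `k` is lifted and lowered
  -- again.
  (ULift.algEquiv.{u, u, max u w} (R := k) (A := k)).toAlgHom.comp
    (lift (AntipodeTower.counit.map (ULift.algEquiv.{u, u, max u w} (R := k) (A := k)).symm.toAlgHom))

/-- The antipode of the universal algebra. -/
noncomputable def antipodeHom : TowerAlgebra k σ B →ₐ[k] (TowerAlgebra k σ B)ᵐᵒᵖ :=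
  lift (univ k σ B).shift

@[simp]
theorem comulHom_x (m : I) (b : B) : comulHom (k := k) (σ := σ) (x m b) =
    ∑ i ∈ (ℛ k b).index, x m ((ℛ k b).left i) ⊗ₜ[k] x m ((ℛ k b).right i) := by
  simp [comulHom, ← (ℛ k b).eq]

@[simp]
theorem comulHom_y (m : I) (b : B) : comulHom (k := k) (σ := σ) (y m b) =
    ∑ i ∈ (ℛ k b).index, y m ((ℛ k b).right i) ⊗ₜ[k] y m ((ℛ k b).left i) := by
  simp only [comulHom, lift_y, tensor_antiHom, Bialgebra.comulOpAlgHom]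
  simp [← (ℛ k b).eq]

@[simp]
theorem counitHom_x (m : I) (b : B) :
    counitHom (k := k) (σ := σ) (x m b) = Coalgebra.counit (R := k) b := by
  simp [counitHom]

@[simp]
theorem counitHom_y (m : I) (b : B) :
    counitHom (k := k) (σ := σ) (y m b) = Coalgebra.counit (R := k) b := by
  simp [counitHom]

@[simp]
theorem antipodeHom_x (m : I) (b : B) : antipodeHom (k := k) (σ := σ) (x m b) = op (y m b) := by
  simp [antipodeHom]

@[simp]
theorem antipodeHom_y (m : I) (b : B) :
    antipodeHom (k := k) (σ := σ) (y m b) = op (x (σ m) b) := by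
  simp [antipodeHom]

variable [hσ : Based σ]

/-- Both sides of each axiom are algebra maps, so it suffices to compare them on the base
generators, where the axiom is that of `B`. -/
noncomputable instance : Bialgebra k (TowerAlgebra k σ B) :=
  .ofAlgHom comulHom counitHom
    (hom_ext hσ.generates fun b => by
      simp [TensorProduct.sum_tmul, TensorProduct.tmul_sum]
      exact (sum_map_tmul_tmul_eq (xHom hσ.base) (xHom hσ.base) (xHom hσ.base) b).symm)
    (hom_ext hσ.generates fun b => by
      simpa using sum_counit_tmul_map_eq (xHom (k := k) (σ := σ) hσ.base) b (repr := ℛ k b))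
    (hom_ext hσ.generates fun b => by
      simpa using sum_map_tmul_counit_eq (xHom (k := k) (σ := σ) hσ.base) b (repr := ℛ k b))

theorem comul_def (a : TowerAlgebra k σ B) : comul (R := k) a = comulHom a := rfl

theorem counit_def (a : TowerAlgebra k σ B) : Coalgebra.counit (R := k) a = counitHom a := rfl

/-- The homomorphisms of the universal tower, as bialgebra homomorphisms. -/
noncomputable def xBialgHom (m : I) : B →ₐc[k] TowerAlgebra k σ B :=
  .ofAlgHom (xHom m) (by ext b; simp [counit_def]) (by ext b; simp [comul_def, ← (ℛ k b).eq])

/-- A convolution product of algebra maps need not be multiplicative, so `hom_ext` does not apply.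
The identities are checked on all generators instead, where they are the defining relations of the
tower. -/
theorem isConvInverse_antipodeHom :
    IsConvInverse (AlgHom.id k (TowerAlgebra k σ B)) antipodeHom := by
  refine .of_adjoin_eq_top adjoin_range_gen ?_ ?_
  all_goals
    rintro _ ⟨⟨m, b⟩ | ⟨m, b⟩, rfl⟩
  · change LinearMap.mul' k _ (TensorProduct.map _ _ (comulHom (x m b))) = algebraMap k _ (counitHom (x m b))
    simpa using ((univ k σ B).hom_antiHom m).sum_mul_unop (ℛ k b)
  · change LinearMap.mul' k _ (TensorProduct.map _ _ (comulHom (y m b))) = algebraMap k _ (counitHom (y m b))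
    -- On `y m b` the comultiplication is reversed, so the left and right inverse relations trade
    -- places.
    simpa using congr(unop $(((univ k σ B).antiHom_hom m).sum_unop_mul (ℛ k b)))
  · change LinearMap.mul' k _ (TensorProduct.map _ _ (comulHom (x m b))) = algebraMap k _ (counitHom (x m b))
    simpa using ((univ k σ B).hom_antiHom m).sum_unop_mul (ℛ k b)
  · change LinearMap.mul' k _ (TensorProduct.map _ _ (comulHom (y m b))) = algebraMap k _ (counitHom (y m b))
    simpa using congr(unop $(((univ k σ B).antiHom_hom m).sum_mul_unop (ℛ k b)))

noncomputable instance : HopfAlgebra k (TowerAlgebra k σ B) :=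
  .ofIsConvInverse antipodeHom isConvInverse_antipodeHom

theorem antipode_eq (a : TowerAlgebra k σ B) :
    HopfAlgebra.antipode k a = unop (antipodeHom a) := rfl

variable (k σ B) in
/-- The canonical homomorphism to the universal algebra. -/
noncomputable def unit : B →ₐc[k] TowerAlgebra k σ B := xBialgHom hσ.base

theorem hom_ext' {R : Type*} [Ring R] [Algebra k R]
    {f g : TowerAlgebra k σ B →ₐ[k] R} (h : ∀ b, f (unit k σ B b) = g (unit k σ B b)) : f = g :=
  hom_ext hσ.generates h

/-- When `σ` is invertible the tower can also be shifted backwards; this induces the inverse `T` of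
the antipode. Both composites are algebra maps into the double opposite, so comparing them on the
base suffices. -/
theorem bijective_antipode (τ : I → I) (h : ∀ m, σ (τ m) = m) (h' : ∀ m, τ (σ m) = m) :
    Function.Bijective (HopfAlgebra.antipode k (A := TowerAlgebra k σ B)) := by
  let S : TowerAlgebra k σ B →ₐ[k] (TowerAlgebra k σ B)ᵐᵒᵖ := antipodeHom
  let T : TowerAlgebra k σ B →ₐ[k] (TowerAlgebra k σ B)ᵐᵒᵖ := lift ((univ k σ B).unshift τ h h')
  have h₁ : (AlgHom.op T).comp S = (AlgEquiv.opOp k _).toAlgHom :=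
    hom_ext hσ.generates fun b => by simp [S, T]
  have h₂ : (AlgHom.op S).comp T = (AlgEquiv.opOp k _).toAlgHom :=
    hom_ext hσ.generates fun b => by simp [S, T, h]
  rw [Function.bijective_iff_has_inverse]
  refine ⟨fun a => unop (T a), fun a => ?_, fun a => ?_⟩
  · simpa [antipode_eq] using congr(unop (unop ($h₁ a)))
  · simpa [antipode_eq] using congr(unop (unop ($h₂ a)))

/-- The tower in a Hopf algebra generated by a bialgebra homomorphism. -/
noncomputable def hopfTower {L : Type*} [Ring L] [HopfAlgebra k L] (f : B →ₐc[k] L)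
    (X : I → L →ₐ[k] L)
    (hX : ∀ m a, X (σ m) a = HopfAlgebra.antipode k (HopfAlgebra.antipode k (X m a)))
    (hX' : ∀ m a, X m (HopfAlgebra.antipode k a) = HopfAlgebra.antipode k (X m a)) :
    AntipodeTower k σ B L :=
  have key (m : I) : IsConvInverse ((X m).comp (f : B →ₐ[k] L))
      ((HopfAlgebra.antipodeAlgHomOp k L).comp ((X m).comp (f : B →ₐ[k] L))) := by
    have e : (HopfAlgebra.antipodeAlgHomOp k L).comp ((X m).comp (f : B →ₐ[k] L)) =
        (AlgHom.op (X m)).comp ((HopfAlgebra.antipodeAlgHomOp k L).comp (f : B →ₐ[k] L)) := by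
      ext b
      simp [hX']
    rw [e]
    exact ((HopfAlgebra.isConvInverse_antipode (k := k) (L := L)).precomp f).map (X m)
  { hom := fun m => (X m).comp (f : B →ₐ[k] L)
    antiHom := fun m => (HopfAlgebra.antipodeAlgHomOp k L).comp ((X m).comp (f : B →ₐ[k] L))
    hom_antiHom := key
    antiHom_hom := fun m => by
      convert (key m).map (HopfAlgebra.antipodeAlgHomOp k L) using 1
      ext b
      simp [hX] }

/-- Here `X m` plays the role of `S^(2m)`, with `m` natural or an integer. The tower `X m ∘ f`, `S ∘
X m ∘ f` induces the extension, which respects the coalgebra structure because it does so on the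
base. -/
theorem exists_bialgHom {L : Type (max u w)} [Ring L] [HopfAlgebra k L] (f : B →ₐc[k] L)
    (X : I → L →ₐ[k] L) (hX₀ : ∀ a, X hσ.base a = a)
    (hX : ∀ m a, X (σ m) a = HopfAlgebra.antipode k (HopfAlgebra.antipode k (X m a)))
    (hX' : ∀ m a, X m (HopfAlgebra.antipode k a) = HopfAlgebra.antipode k (X m a)) :
    ∃ F : TowerAlgebra k σ B →ₐc[k] L, F.comp (unit k σ B) = f := by
  have h (b : B) : lift (hopfTower f X hX hX') (x hσ.base b) = f b := by
    simp [hopfTower, hX₀]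
  refine ⟨.ofAlgHom (lift (hopfTower f X hX hX')) (hom_ext hσ.generates fun b => ?_)
    (hom_ext hσ.generates fun b => ?_), BialgHom.ext h⟩
  · change Coalgebra.counit (R := k) (lift _ (x hσ.base b)) = counitHom (x hσ.base b)
    rw [h, counitHom_x]
    simp
  · change Algebra.TensorProduct.map _ _ (comulHom (x hσ.base b)) =
      comul (lift _ (x hσ.base b))
    rw [h, comulHom_x]
    simp [h, ← CoalgHomClass.map_comp_comul_apply, ← (ℛ k b).eq]

end TowerAlgebra
end HopfStructure

/-! ### Colimits of Hopf algebras -/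

section Colimit

open WithConv MulOpposite PresentedAlgebra

section
variable {k : Type u} [CommRing k] {ι : Type w} {Q : ι → Type w} [∀ i, Ring (Q i)]
  [∀ i, HopfAlgebra k (Q i)]

/-- A family of homomorphisms is compatible with a family of transition maps. -/
abbrev IsCompatible (E : ∀ i j, Set (Q i →ₐc[k] Q j)) {R : Type*} [Ring R] [Algebra k R]
    (f : ∀ i, Q i →ₐ[k] R) : Prop :=
  ∀ i j, ∀ h ∈ E i j, ∀ a, f j (h a) = f i a

/-- An assignment of values to symbols that comes from a compatible family of homomorphisms. -/
def IsCompatibleEval (E : ∀ i j, Set (Q i →ₐc[k] Q j)) (R : Type (max u w)) [Ring R] [Algebra k R]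
    (φ : (Σ i, Q i) → R) : Prop :=
  ∃ f : ∀ i, Q i →ₐ[k] R, IsCompatible E f ∧ φ = fun x => f x.1 x.2

/-- The colimit of a family of Hopf algebras along a family of transition maps. -/
abbrev HopfColimit (E : ∀ i j, Set (Q i →ₐc[k] Q j)) : Type (max u w) :=
  PresentedAlgebra (k := k) (IsCompatibleEval E)

end

namespace HopfColimit

variable {k : Type u} [CommRing k] {ι : Type w} {Q : ι → Type w} [∀ i, Ring (Q i)]
  [∀ i, HopfAlgebra k (Q i)] {E : ∀ i j, Set (Q i →ₐc[k] Q j)}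

theorem lift_eq_of_forall {a b : FreeAlgebra k (Σ i, Q i)}
    (h : ∀ (R : Type (max u w)) [Ring R] [Algebra k R] (f : ∀ i, Q i →ₐ[k] R),
      IsCompatible E f → FreeAlgebra.lift k (fun x : Σ i, Q i => f x.1 x.2) a =
        FreeAlgebra.lift k (fun x : Σ i, Q i => f x.1 x.2) b) :
    FreeAlgebra.lift k (gen (IsCompatibleEval E)) a =
      FreeAlgebra.lift k (gen (IsCompatibleEval E)) b :=
  lift_gen_eq_of_forall fun R _ _ φ hφ => by
    obtain ⟨f, hf, rfl⟩ := hφ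
    exact h R f hf

variable (E) in
/-- The canonical homomorphisms to the colimit. -/
noncomputable def inclHom (i : ι) : Q i →ₐ[k] HopfColimit E where
  toFun a := gen _ ⟨i, a⟩
  map_one' := by
    have := lift_eq_of_forall (E := E) (a := FreeAlgebra.ι k ⟨i, 1⟩) (b := 1)
      fun R _ _ f _ => by simp
    simpa using this
  map_mul' a b := by
    have := lift_eq_of_forall (E := E) (a := FreeAlgebra.ι k ⟨i, a * b⟩)
      (b := FreeAlgebra.ι k ⟨i, a⟩ * FreeAlgebra.ι k ⟨i, b⟩) fun R _ _ f _ => by simp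
    simpa using this
  map_zero' := by
    have := lift_eq_of_forall (E := E) (a := FreeAlgebra.ι k ⟨i, 0⟩) (b := 0)
      fun R _ _ f _ => by simp
    simpa using this
  map_add' a b := by
    have := lift_eq_of_forall (E := E) (a := FreeAlgebra.ι k ⟨i, a + b⟩)
      (b := FreeAlgebra.ι k ⟨i, a⟩ + FreeAlgebra.ι k ⟨i, b⟩) fun R _ _ f _ => by simp
    simpa using this
  commutes' r := by
    have := lift_eq_of_forall (E := E) (a := FreeAlgebra.ι k ⟨i, algebraMap k _ r⟩)
      (b := algebraMap k _ r) fun R _ _ f _ => by simp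
    simpa using this

theorem isCompatible_inclHom : IsCompatible E (inclHom E) := fun i j h hh a => by
  have := lift_eq_of_forall (E := E) (a := FreeAlgebra.ι k ⟨j, h a⟩) (b := FreeAlgebra.ι k ⟨i, a⟩)
    fun R _ _ f hf => by simpa using hf i j h hh a
  rw [FreeAlgebra.lift_ι_apply, FreeAlgebra.lift_ι_apply] at this
  exact this

/-- The homomorphism from the colimit determined by a compatible family. -/
noncomputable def descHom {R : Type (max u w)} [Ring R] [Algebra k R] (f : ∀ i, Q i →ₐ[k] R)
    (hf : IsCompatible E f) : HopfColimit E →ₐ[k] R :=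
  PresentedAlgebra.lift _ ⟨f, hf, rfl⟩

@[simp]
theorem descHom_inclHom {R : Type (max u w)} [Ring R] [Algebra k R] (f : ∀ i, Q i →ₐ[k] R)
    (hf : IsCompatible E f) (i : ι) (a : Q i) : descHom f hf (inclHom E i a) = f i a :=
  lift_gen _ _ _

theorem hom_ext {R : Type*} [Ring R] [Algebra k R] {f g : HopfColimit E →ₐ[k] R}
    (h : ∀ i a, f (inclHom E i a) = g (inclHom E i a)) : f = g :=
  PresentedAlgebra.algHom_ext fun x => h x.1 x.2

variable (E) in
theorem adjoin_range_inclHom :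
    Algebra.adjoin k (Set.range fun x : Σ i, Q i => inclHom E x.1 x.2) = ⊤ :=
  adjoin_range_gen

theorem _root_.IsCompatible.comp {R R' : Type*} [Ring R] [Algebra k R] [Ring R'] [Algebra k R']
    {f : ∀ i, Q i →ₐ[k] R} (hf : IsCompatible E f) (φ : R →ₐ[k] R') :
    IsCompatible E fun i => φ.comp (f i) :=
  fun i j h hh a => congr(φ $(hf i j h hh a))

theorem isCompatible_counit : IsCompatible E fun i => Bialgebra.counitAlgHom k (Q i) :=
  fun _ _ h _ a => by simp

/-- The comultiplication of the colimit. -/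
noncomputable def comulHom : HopfColimit E →ₐ[k] HopfColimit E ⊗[k] HopfColimit E :=
  descHom (fun i => (Algebra.TensorProduct.map (inclHom E i) (inclHom E i)).comp
    (Bialgebra.comulAlgHom k (Q i))) fun i j h hh a => by
      have (t : Q i ⊗[k] Q i) : Algebra.TensorProduct.map (inclHom E j) (inclHom E j)
          (TensorProduct.map (h : Q i →ₗ[k] Q j) (h : Q i →ₗ[k] Q j) t) =
          Algebra.TensorProduct.map (inclHom E i) (inclHom E i) t := by
        induction t with
        | zero => simp
        | tmul a b => simp [isCompatible_inclHom i j h hh]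
        | add a b ha hb => simp only [map_add, ha, hb]
      simp [← CoalgHomClass.map_comp_comul_apply, this]

/-- The counit of the colimit. -/
noncomputable def counitHom : HopfColimit E →ₐ[k] k :=
  (ULift.algEquiv.{u, u, max u w} (R := k) (A := k)).toAlgHom.comp
    (descHom (fun i => (ULift.algEquiv.{u, u, max u w} (R := k) (A := k)).symm.toAlgHom.comp
      (Bialgebra.counitAlgHom k (Q i))) (isCompatible_counit.comp _))

/-- The antipode of the colimit. -/
noncomputable def antipodeHom : HopfColimit E →ₐ[k] (HopfColimit E)ᵐᵒᵖ :=
  descHom (fun i => (AlgHom.op (inclHom E i)).comp (HopfAlgebra.antipodeAlgHomOp k (Q i)))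
    fun i j h hh a => by
      simp [← BialgHom.map_antipode, isCompatible_inclHom i j h hh]

@[simp]
theorem comulHom_inclHom (i : ι) (a : Q i) : comulHom (inclHom E i a) =
    ∑ m ∈ (ℛ k a).index, inclHom E i ((ℛ k a).left m) ⊗ₜ[k] inclHom E i ((ℛ k a).right m) := by
  rw [comulHom, descHom_inclHom]
  simp [← (ℛ k a).eq]

@[simp]
theorem counitHom_inclHom (i : ι) (a : Q i) :
    counitHom (inclHom E i a) = Coalgebra.counit (R := k) a := by
  simp [counitHom]

@[simp]
theorem antipodeHom_inclHom (i : ι) (a : Q i) :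
    antipodeHom (inclHom E i a) = op (inclHom E i (HopfAlgebra.antipode k a)) := by
  simp [antipodeHom]

noncomputable instance : Bialgebra k (HopfColimit E) :=
  .ofAlgHom comulHom counitHom
    (hom_ext fun i a => by
      simp [TensorProduct.sum_tmul, TensorProduct.tmul_sum]
      exact (sum_map_tmul_tmul_eq (inclHom E i) (inclHom E i) (inclHom E i) a).symm)
    (hom_ext fun i a => by
      simp)
    (hom_ext fun i a => by
      simp)

theorem comul_def (a : HopfColimit E) : comul (R := k) a = comulHom a := rfl

theorem counit_def (a : HopfColimit E) : Coalgebra.counit (R := k) a = counitHom a := rfl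

variable (E) in
/-- The canonical bialgebra homomorphisms to the colimit. -/
noncomputable def incl (i : ι) : Q i →ₐc[k] HopfColimit E :=
  .ofAlgHom (inclHom E i) (by ext a; simp [counit_def]) (by ext a; simp [comul_def, ← (ℛ k a).eq])

theorem isConvInverse_antipodeHom :
    IsConvInverse (AlgHom.id k (HopfColimit E)) antipodeHom := by
  refine .of_adjoin_eq_top (adjoin_range_inclHom E) ?_ ?_
  all_goals
    rintro _ ⟨⟨i, a⟩, rfl⟩
    change LinearMap.mul' k _ (TensorProduct.map _ _ (comulHom (inclHom E i a))) =
      algebraMap k _ (counitHom (inclHom E i a))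
  · simpa using congr(inclHom E i $(HopfAlgebra.sum_mul_antipode_eq_algebraMap_counit (ℛ k a)))
  · simpa using congr(inclHom E i $(HopfAlgebra.sum_antipode_mul_eq_algebraMap_counit (ℛ k a)))

noncomputable instance : HopfAlgebra k (HopfColimit E) :=
  .ofIsConvInverse antipodeHom isConvInverse_antipodeHom

theorem antipode_eq (a : HopfColimit E) : HopfAlgebra.antipode k a = unop (antipodeHom a) := rfl

theorem incl_comp {i j : ι} {h : Q i →ₐc[k] Q j} (hh : h ∈ E i j) (a : Q i) :
    incl E j (h a) = incl E i a :=
  isCompatible_inclHom i j h hh a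

theorem bialgHom_ext {R : Type*} [Ring R] [Bialgebra k R] {f g : HopfColimit E →ₐc[k] R}
    (h : ∀ i a, f (incl E i a) = g (incl E i a)) : f = g := by
  have : (f : HopfColimit E →ₐ[k] R) = g := hom_ext h
  exact BialgHom.ext fun a => congr($this a)

/-- The bialgebra homomorphism from the colimit determined by a compatible family. -/
noncomputable def desc {R : Type (max u w)} [Ring R] [Bialgebra k R] (f : ∀ i, Q i →ₐc[k] R)
    (hf : IsCompatible E fun i => (f i : Q i →ₐ[k] R)) : HopfColimit E →ₐc[k] R :=
  .ofAlgHom (descHom _ hf)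
    (hom_ext fun i a => by
      change Coalgebra.counit (R := k) (descHom _ _ (inclHom E i a)) = counitHom (inclHom E i a)
      simp)
    (hom_ext fun i a => by
      change Algebra.TensorProduct.map _ _ (comulHom (inclHom E i a)) =
        comul (descHom _ _ (inclHom E i a))
      simp [← CoalgHomClass.map_comp_comul_apply, ← (ℛ k a).eq])

@[simp]
theorem desc_incl {R : Type (max u w)} [Ring R] [Bialgebra k R] (f : ∀ i, Q i →ₐc[k] R)
    (hf : IsCompatible E fun i => (f i : Q i →ₐ[k] R)) (i : ι) (a : Q i) :
    desc f hf (incl E i a) = f i a :=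
  descHom_inclHom _ _ _ _

end HopfColimit

/-- The inverse of a bijective antipode, as an anti-endomorphism. -/
noncomputable def HopfAlgebra.antipodeInv {k : Type*} [CommRing k] {L : Type*} [Ring L]
    [HopfAlgebra k L] (hS : Function.Bijective (HopfAlgebra.antipode k (A := L))) : L →ₐ[k] Lᵐᵒᵖ :=
  let e := LinearEquiv.ofBijective (HopfAlgebra.antipode k (A := L)) hS
  .ofLinearMap ((MulOpposite.opLinearEquiv k).toLinearMap ∘ₗ e.symm.toLinearMap)
    (unop_injective (e.injective (by simp [e])))
    (fun a b => unop_injective (e.injective (by simp [e, HopfAlgebra.antipode_mul_antidistrib])))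

@[simp]
theorem HopfAlgebra.antipode_antipodeInv {k : Type*} [CommRing k] {L : Type*} [Ring L]
    [HopfAlgebra k L] (hS : Function.Bijective (HopfAlgebra.antipode k (A := L))) (a : L) :
    HopfAlgebra.antipode k (unop (HopfAlgebra.antipodeInv hS a)) = a :=
  (LinearEquiv.ofBijective (HopfAlgebra.antipode k (A := L)) hS).apply_symm_apply a

@[simp]
theorem HopfAlgebra.antipodeInv_antipode {k : Type*} [CommRing k] {L : Type*} [Ring L]
    [HopfAlgebra k L] (hS : Function.Bijective (HopfAlgebra.antipode k (A := L))) (a : L) :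
    HopfAlgebra.antipodeInv hS (HopfAlgebra.antipode k a) = op a :=
  congrArg op ((LinearEquiv.ofBijective (HopfAlgebra.antipode k (A := L)) hS).symm_apply_apply a)

theorem HopfColimit.bijective_antipode {k : Type u} [CommRing k] {ι : Type w} {Q : ι → Type w}
    [∀ i, Ring (Q i)] [∀ i, HopfAlgebra k (Q i)] {E : ∀ i j, Set (Q i →ₐc[k] Q j)}
    (hS : ∀ i, Function.Bijective (HopfAlgebra.antipode k (A := Q i))) :
    Function.Bijective (HopfAlgebra.antipode k (A := HopfColimit E)) := by
  let S : HopfColimit E →ₐ[k] (HopfColimit E)ᵐᵒᵖ := antipodeHom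
  let T : HopfColimit E →ₐ[k] (HopfColimit E)ᵐᵒᵖ :=
    descHom (fun i => (AlgHom.op (inclHom E i)).comp (HopfAlgebra.antipodeInv (hS i)))
      fun i j h hh a => by
        -- Writing the element as an antipode reduces compatibility with `S⁻¹` to compatibility with
        -- `S`.
        obtain ⟨a, rfl⟩ := (hS i).2 a
        simp [BialgHom.map_antipode, isCompatible_inclHom i j h hh]
  have h₁ : (AlgHom.op T).comp S = (AlgEquiv.opOp k _).toAlgHom :=
    hom_ext fun i a => by simp [S, T]
  have h₂ : (AlgHom.op S).comp T = (AlgEquiv.opOp k _).toAlgHom :=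
    hom_ext fun i a => by simp [S, T]
  rw [Function.bijective_iff_has_inverse]
  refine ⟨fun a => unop (T a), fun a => ?_, fun a => ?_⟩
  · simpa [antipode_eq] using congr(unop (unop ($h₁ a)))
  · simpa [antipode_eq] using congr(unop (unop ($h₂ a)))

end Colimit

/-! ### Hopf subalgebras over a field -/

section HopfSubalgebra

variable {k : Type*} [Field k]

/-- Modules over a field are flat. This lets the comultiplication of `H` restrict to a subalgebra
`W`, as `W ⊗ W` embeds in `H ⊗ H`. -/
theorem Algebra.TensorProduct.map_injective_of_field {Q Q' H H' : Type*} [Ring Q] [Algebra k Q]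
    [Ring Q'] [Algebra k Q'] [Ring H] [Algebra k H] [Ring H'] [Algebra k H'] {f : Q →ₐ[k] H}
    {g : Q' →ₐ[k] H'} (hf : Function.Injective f) (hg : Function.Injective g) :
    Function.Injective (Algebra.TensorProduct.map f g) :=
  TensorProduct.map_injective_of_flat_flat f.toLinearMap g.toLinearMap hf hg

/-- A subalgebra of a Hopf algebra over a field that is closed under the comultiplication and the
antipode is a Hopf algebra. -/
theorem Subalgebra.exists_hopfAlgebra {Q H : Type*} [Ring H] [HopfAlgebra k H]
    (W : Subalgebra k H) (e : Q ≃ W)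
    (hcomul : ∀ a ∈ W, comul (R := k) a ∈ (Algebra.TensorProduct.map W.val W.val).range)
    (hS : ∀ a ∈ W, HopfAlgebra.antipode k a ∈ W) :
    ∃ (_ : Ring Q) (_ : HopfAlgebra k Q) (J : Q →ₐc[k] H), ∀ q, J q = e q := by
  -- The structure is carried by `Q` rather than by `W` so that it can later be put on a quotient of
  -- a fixed set.
  let := e.ring
  let := e.algebra k
  let E : Q ≃ₐ[k] W := e.algEquiv k
  let j : Q →ₐ[k] H := W.val.comp E.toAlgHom
  have hj : Function.Injective j := Subtype.val_injective.comp E.injective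
  replace hcomul (q : Q) : comul (R := k) (j q) ∈ (Algebra.TensorProduct.map j j).range := by
    obtain ⟨t, ht⟩ := hcomul (j q) (E q).2
    refine ⟨Algebra.TensorProduct.map E.symm.toAlgHom E.symm.toAlgHom t, ?_⟩
    rw [← ht]
    change ((Algebra.TensorProduct.map j j).comp
      (Algebra.TensorProduct.map E.symm.toAlgHom E.symm.toAlgHom)) t = _
    rw [← Algebra.TensorProduct.map_comp]
    have : j.comp E.symm.toAlgHom = W.val := by
      ext a
      simp [j]
    rw [this]
    rfl
  replace hS (q : Q) : HopfAlgebra.antipode k (j q) ∈ j.range := by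
    obtain ⟨q', hq'⟩ := e.surjective ⟨_, hS (j q) (E q).2⟩
    exact ⟨q', congr_arg Subtype.val hq'⟩
  have hjj := Algebra.TensorProduct.map_injective_of_field hj hj
  have hjjj := Algebra.TensorProduct.map_injective_of_field hj hjj
  let Δ : Q →ₐ[k] Q ⊗[k] Q := (AlgEquiv.ofInjective _ hjj).symm.toAlgHom.comp
    (((Bialgebra.comulAlgHom k H).comp j).codRestrict _ hcomul)
  have hΔ (q : Q) : Algebra.TensorProduct.map j j (Δ q) = comul (j q) :=
    congr_arg Subtype.val ((AlgEquiv.ofInjective _ hjj).apply_symm_apply _)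
  let S : Q →ₗ[k] Q := (LinearEquiv.ofInjective j.toLinearMap hj).symm.toLinearMap ∘ₗ
    LinearMap.codRestrict _ (HopfAlgebra.antipode k ∘ₗ j.toLinearMap) hS
  have hSj (q : Q) : j (S q) = HopfAlgebra.antipode k (j q) :=
    congr_arg Subtype.val ((LinearEquiv.ofInjective j.toLinearMap hj).apply_symm_apply _)
  -- Each axiom is verified after applying an injective tensor product built from `j`, where it
  -- becomes an axiom of `H`.
  let : Bialgebra k Q := .ofAlgHom Δ ((Bialgebra.counitAlgHom k H).comp j)
    (by
      ext q
      apply hjjj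
      have h₁ (t : Q ⊗[k] Q) : Algebra.TensorProduct.map j (Algebra.TensorProduct.map j j)
          (Algebra.TensorProduct.assoc k k k Q Q Q
            (Algebra.TensorProduct.map Δ (AlgHom.id k Q) t)) =
          TensorProduct.assoc k H H H (comul.rTensor H (Algebra.TensorProduct.map j j t)) := by
        induction t with
        | zero => simp
        | add a b ha hb => simp only [map_add, ha, hb]
        | tmul a b =>
          have (s : Q ⊗[k] Q) : Algebra.TensorProduct.map j (Algebra.TensorProduct.map j j)
              (Algebra.TensorProduct.assoc k k k Q Q Q (s ⊗ₜ b)) =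
              TensorProduct.assoc k H H H (Algebra.TensorProduct.map j j s ⊗ₜ j b) := by
            induction s with
            | zero => simp
            | add c d hc hd => simp only [TensorProduct.add_tmul, map_add, hc, hd]
            | tmul c d => simp
          simp [this, hΔ]
      have h₂ (t : Q ⊗[k] Q) : Algebra.TensorProduct.map j (Algebra.TensorProduct.map j j)
            (Algebra.TensorProduct.map (AlgHom.id k Q) Δ t) =
          comul.lTensor H (Algebra.TensorProduct.map j j t) := by
        induction t with
        | zero => simp
        | add a b ha hb => simp only [map_add, ha, hb]
        | tmul a b => simp [hΔ]
      simp [h₁, h₂, hΔ])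
    (by
      ext q
      apply Algebra.TensorProduct.map_injective_of_field (f := AlgHom.id k k)
        Function.injective_id hj
      have (t : Q ⊗[k] Q) : Algebra.TensorProduct.map (AlgHom.id k k) j
          (Algebra.TensorProduct.map ((Bialgebra.counitAlgHom k H).comp j) (AlgHom.id k Q) t) =
          (Coalgebra.counit (R := k)).rTensor H (Algebra.TensorProduct.map j j t) := by
        induction t with
        | zero => simp
        | add a b ha hb => simp only [map_add, ha, hb]
        | tmul a b => simp
      simp [this, hΔ])
    (by
      ext q
      apply Algebra.TensorProduct.map_injective_of_field (g := AlgHom.id k k)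
        hj Function.injective_id
      have (t : Q ⊗[k] Q) : Algebra.TensorProduct.map j (AlgHom.id k k)
          (Algebra.TensorProduct.map (AlgHom.id k Q) ((Bialgebra.counitAlgHom k H).comp j) t) =
          (Coalgebra.counit (R := k)).lTensor H (Algebra.TensorProduct.map j j t) := by
        induction t with
        | zero => simp
        | add a b ha hb => simp only [map_add, ha, hb]
        | tmul a b => simp
      simp [this, hΔ])
  have hcounit (q : Q) : Coalgebra.counit (R := k) q = Coalgebra.counit (R := k) (j q) := rfl
  refine ⟨_, .ofConvInverse S ?_ ?_, .ofAlgHom j (by ext; rfl) (AlgHom.ext hΔ), fun _ => rfl⟩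
  · ext q
    apply hj
    have (t : Q ⊗[k] Q) : j (LinearMap.mul' k Q (TensorProduct.map S LinearMap.id t)) =
        LinearMap.mul' k H ((HopfAlgebra.antipode k).rTensor H
          (Algebra.TensorProduct.map j j t)) := by
      induction t with
      | zero => simp
      | add a b ha hb => simp only [map_add, ha, hb]
      | tmul a b => simp [hSj]
    refine (this (Δ q)).trans ?_
    simp [hΔ, hcounit]
  · ext q
    apply hj
    have (t : Q ⊗[k] Q) : j (LinearMap.mul' k Q (TensorProduct.map LinearMap.id S t)) =
        LinearMap.mul' k H ((HopfAlgebra.antipode k).lTensor H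
          (Algebra.TensorProduct.map j j t)) := by
      induction t with
      | zero => simp
      | add a b ha hb => simp only [map_add, ha, hb]
      | tmul a b => simp [hSj]
    refine (this (Δ q)).trans ?_
    simp [hΔ, hcounit]

/-- The factorization through the injective `j'` respects comultiplication because `j' ⊗ j'` is
again injective. -/
theorem BialgHom.exists_factor {Q Q' H : Type*} [Ring Q] [Bialgebra k Q] [Ring Q'] [Bialgebra k Q']
    [Ring H] [Bialgebra k H] (j : Q →ₐc[k] H) (j' : Q' →ₐc[k] H) (hj' : Function.Injective j')
    (h : Set.range j ⊆ Set.range j') : ∃ f : Q →ₐc[k] Q', ∀ a, j' (f a) = j a := by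
  let F : Q →ₐ[k] Q' := (AlgEquiv.ofInjective (j' : Q' →ₐ[k] H) hj').symm.toAlgHom.comp
    ((j : Q →ₐ[k] H).codRestrict _ fun a => h ⟨a, rfl⟩)
  have hF (a : Q) : j' (F a) = j a :=
    congr_arg Subtype.val ((AlgEquiv.ofInjective (j' : Q' →ₐ[k] H) hj').apply_symm_apply _)
  refine ⟨.ofAlgHom F ?_ ?_, hF⟩
  · ext a
    have h₁ : Coalgebra.counit (R := k) (j' (F a)) = Coalgebra.counit (R := k) (j a) := by rw [hF]
    simpa using h₁
  · ext a
    apply Algebra.TensorProduct.map_injective_of_field (f := (j' : Q' →ₐ[k] H))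
      (g := (j' : Q' →ₐ[k] H)) hj' hj'
    have (t : Q ⊗[k] Q) : Algebra.TensorProduct.map (j' : Q' →ₐ[k] H) (j' : Q' →ₐ[k] H)
        (Algebra.TensorProduct.map F F t) =
        TensorProduct.map (j : Q →ₗ[k] H) (j : Q →ₗ[k] H) t := by
      induction t with
      | zero => simp
      | add a b ha hb => simp only [map_add, ha, hb]
      | tmul a b => simp [hF]
    have h₂ (t : Q' ⊗[k] Q') : Algebra.TensorProduct.map (j' : Q' →ₐ[k] H) (j' : Q' →ₐ[k] H) t =
        TensorProduct.map (j' : Q' →ₗ[k] H) (j' : Q' →ₗ[k] H) t := rfl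
    simp only [AlgHom.comp_apply, Bialgebra.comulAlgHom_apply, this]
    rw [h₂, CoalgHomClass.map_comp_comul_apply, CoalgHomClass.map_comp_comul_apply, hF]

end HopfSubalgebra

/-! ### Hopf subalgebras of countable dimension -/

theorem Set.Countable.exists_mul_closed {H : Type*} [Mul H] {X : Set H} (hX : X.Countable)
    (F : H → Set H) (hF : ∀ y, (F y).Countable) :
    ∃ Y : Set H, Y.Countable ∧ X ⊆ Y ∧ (∀ y ∈ Y, F y ⊆ Y) ∧ ∀ a ∈ Y, ∀ b ∈ Y, a * b ∈ Y := by
  let Z : ℕ → Set H := fun n => n.rec X fun _ Z => Z ∪ (⋃ y ∈ Z, F y) ∪ Set.image2 (· * ·) Z Z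
  have hZ (n : ℕ) : (Z n).Countable := by
    induction n with
    | zero => exact hX
    | succ n ih => exact (ih.union (ih.biUnion fun y _ => hF y)).union (ih.image2 ih _)
  have hmono : Monotone Z := monotone_nat_of_le_succ fun n _ hx => Or.inl (Or.inl hx)
  refine ⟨⋃ n, Z n, Set.countable_iUnion hZ, Set.subset_iUnion Z 0, ?_, ?_⟩
  · intro y hy a ha
    obtain ⟨n, hn⟩ := Set.mem_iUnion.1 hy
    exact Set.mem_iUnion.2 ⟨n + 1, Or.inl (Or.inr (Set.mem_biUnion hn ha))⟩
  · intro a ha b hb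
    obtain ⟨n, hn⟩ := Set.mem_iUnion.1 ha
    obtain ⟨m, hm⟩ := Set.mem_iUnion.1 hb
    exact Set.mem_iUnion.2 ⟨max n m + 1, Or.inr
      ⟨a, hmono (le_max_left n m) hn, b, hmono (le_max_right n m) hm, rfl⟩⟩

/-- Every countable subset of a Hopf algebra is contained in a subalgebra of countable dimension
that is closed under the comultiplication, the antipode and, if the antipode is bijective, its
inverse. -/
theorem HopfAlgebra.exists_countable_subalgebra {k : Type*} [Field k] {H : Type*} [Ring H]
    [HopfAlgebra k H] {p : Prop} (hp : p → Function.Bijective (HopfAlgebra.antipode k (A := H)))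
    {X : Set H} (hX : X.Countable) :
    ∃ (W : Subalgebra k H) (Y : Set H), Y.Countable ∧ Y.Nonempty ∧
      Submodule.span k Y = Subalgebra.toSubmodule W ∧ X ⊆ W ∧
      (∀ a ∈ W, comul (R := k) a ∈ (Algebra.TensorProduct.map W.val W.val).range) ∧
      (∀ a ∈ W, HopfAlgebra.antipode k a ∈ W) ∧
      (p → ∀ a ∈ W, ∃ b ∈ W, HopfAlgebra.antipode k b = a) := by
  -- `T` is the inverse antipode if `p` holds and the dummy value `0` otherwise, so one closure
  -- argument serves both cases.
  obtain ⟨T, hT⟩ : ∃ T : H →ₗ[k] H, p → ∀ a, HopfAlgebra.antipode k (T a) = a := by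
    by_cases h : p
    · exact ⟨(LinearEquiv.ofBijective _ (hp h)).symm.toLinearMap,
        fun _ => (LinearEquiv.ofBijective _ (hp h)).apply_symm_apply⟩
    · exact ⟨0, fun h' => (h h').elim⟩
  -- `Y` is closed under products, `S`, `T` and taking the finitely many legs of a chosen expression
  -- for the comultiplication, so its span `W` inherits all the structure.
  obtain ⟨Y, hY, hXY, hF, hmul⟩ := (hX.insert 1).exists_mul_closed
    (fun y => {HopfAlgebra.antipode k y, T y} ∪ ((ℛ k y).left '' (ℛ k y).index ∪
      (ℛ k y).right '' (ℛ k y).index)) (fun y => (Set.Finite.union (Set.toFinite _)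
        (((Finset.finite_toSet _).image _).union ((Finset.finite_toSet _).image _))).countable)
  have hYY : Submodule.span k Y * Submodule.span k Y ≤ Submodule.span k Y := by
    rw [Submodule.span_mul_span]
    refine Submodule.span_mono ?_
    rintro _ ⟨a, ha, b, hb, rfl⟩
    exact hmul a ha b hb
  let W : Subalgebra k H := (Submodule.span k Y).toSubalgebra
    (Submodule.subset_span (hXY (Set.mem_insert _ _)))
    fun a b ha hb => hYY (Submodule.mul_mem_mul ha hb)
  have hmap (f : H →ₗ[k] H) (hf : ∀ y ∈ Y, f y ∈ Y) (a : H) (ha : a ∈ W) : f a ∈ W := by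
    have : Submodule.span k Y ≤ (Submodule.span k Y).comap f :=
      Submodule.span_le.2 fun y hy => Submodule.subset_span (hf y hy)
    exact this ha
  refine ⟨W, Y, hY, ⟨1, hXY (Set.mem_insert _ _)⟩, rfl,
    fun x hx => Submodule.subset_span (hXY (Set.mem_insert_of_mem _ hx)), ?_,
    hmap _ fun y hy => hF y hy (by simp), fun h a ha => ⟨T a, hmap T (fun y hy => hF y hy (by simp))
      a ha, hT h a⟩⟩
  have : Submodule.span k Y ≤ (Subalgebra.toSubmodule
      (Algebra.TensorProduct.map W.val W.val).range).comap (comul (R := k)) := by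
    refine Submodule.span_le.2 fun y hy => ?_
    change comul (R := k) y ∈ (Algebra.TensorProduct.map W.val W.val).range
    rw [← (ℛ k y).eq]
    refine sum_mem fun i hi => ?_
    exact ⟨⟨_, Submodule.subset_span (hF y hy (Or.inr (Or.inl ⟨i, hi, rfl⟩)))⟩ ⊗ₜ
      ⟨_, Submodule.subset_span (hF y hy (Or.inr (Or.inr ⟨i, hi, rfl⟩)))⟩, by simp⟩
  exact this

/-! ### The cofree Hopf algebra over a bialgebra -/

section CofreeHopf

/-- A Hopf algebra of countable dimension over a bialgebra `B`, with bijective antipode if `p`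
holds, whose underlying set is a quotient of a fixed set. -/
structure SmallHopfOver (k : Type u) [Field k] (p : Prop) (B : Type w) [Ring B] [Bialgebra k B] where
  /-- The equivalence relation that defines the underlying set. -/
  rel : Setoid (ULift.{max u w} (ℕ →₀ k))
  /-- The ring structure. -/
  ring : Ring (Quotient rel)
  /-- The Hopf algebra structure. -/
  hopf : HopfAlgebra k (Quotient rel)
  /-- The structure map. -/
  hom : Quotient rel →ₐc[k] B
  bijective : p → Function.Bijective (HopfAlgebra.antipode k (A := Quotient rel))
  exists_countable : ∃ Y : Set (Quotient rel), Y.Countable ∧ Submodule.span k Y = ⊤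

namespace SmallHopfOver

variable {k : Type u} [Field k] {p : Prop} {B : Type w} [Ring B] [Bialgebra k B]

/-- The underlying set. -/
def carrier (i : SmallHopfOver k p B) : Type (max u w) := Quotient i.rel

noncomputable instance (i : SmallHopfOver k p B) : Ring i.carrier := i.ring

noncomputable instance (i : SmallHopfOver k p B) : HopfAlgebra k i.carrier := i.hopf

/-- The structure map. -/
def toBase (i : SmallHopfOver k p B) : i.carrier →ₐc[k] B := i.hom

theorem exists_span_eq_top (i : SmallHopfOver k p B) :
    ∃ Y : Set i.carrier, Y.Countable ∧ Submodule.span k Y = ⊤ :=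
  i.exists_countable

theorem bijective_antipode (i : SmallHopfOver k p B) (h : p) :
    Function.Bijective (HopfAlgebra.antipode k (A := i.carrier)) :=
  i.bijective h

/-- A space with a nonempty countable spanning set is a quotient of `ℕ →₀ k`, so a
countable-dimensional Hopf subalgebra containing `X` is isomorphic to a member of the family,
whatever the universe of `H`. -/
theorem exists_subset_range {H : Type*} [Ring H] [HopfAlgebra k H]
    (hp : p → Function.Bijective (HopfAlgebra.antipode k (A := H))) (g : H →ₐc[k] B) {X : Set H}
    (hX : X.Countable) :
    ∃ (i : SmallHopfOver k p B) (j : i.carrier →ₐc[k] H), Function.Injective j ∧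
      X ⊆ Set.range j ∧ ∀ a, g (j a) = i.toBase a := by
  obtain ⟨W, Y, hY, hY', hYW, hXW, hcomul, hS, hS'⟩ :=
    HopfAlgebra.exists_countable_subalgebra hp hX
  obtain ⟨f, rfl⟩ := hY.exists_eq_range hY'
  let L : (ℕ →₀ k) →ₗ[k] H := Finsupp.linearCombination k f
  have hL : LinearMap.range L = Subalgebra.toSubmodule W := by
    rw [← hYW, Finsupp.range_linearCombination]
  let π : ULift.{max u w} (ℕ →₀ k) → W := fun a => ⟨L a.down, hL.le ⟨_, rfl⟩⟩
  have hπ : Function.Surjective π := fun ⟨a, ha⟩ => by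
    obtain ⟨c, rfl⟩ := hL.ge ha
    exact ⟨⟨c⟩, rfl⟩
  let e : Quotient (Setoid.ker π) ≃ W := Setoid.quotientKerEquivOfSurjective π hπ
  obtain ⟨_, _, J, hJ⟩ := W.exists_hopfAlgebra e hcomul hS
  have hJi : Function.Injective J := fun a b hab => by
    rw [hJ, hJ] at hab
    exact e.injective (Subtype.ext hab)
  have hJr (a : H) (ha : a ∈ W) : ∃ q, J q = a := ⟨e.symm ⟨a, ha⟩, by simp [hJ]⟩
  refine ⟨⟨Setoid.ker π, _, _, g.comp J, fun h => ⟨fun a b hab => ?_, fun a => ?_⟩, ?_⟩, J, hJi,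
    fun x hx => hJr x (hXW hx), fun _ => rfl⟩
  · apply hJi
    apply (hp h).1
    rw [← BialgHom.map_antipode, ← BialgHom.map_antipode, hab]
  · obtain ⟨b, hb, hb'⟩ := hS' h (J a) (by rw [hJ]; exact (e a).2)
    obtain ⟨q, rfl⟩ := hJr b hb
    exact ⟨q, hJi (by rw [BialgHom.map_antipode, hb'])⟩
  · choose q hq using fun n => hJr (f n) (hYW.le (Submodule.subset_span ⟨n, rfl⟩))
    refine ⟨Set.range q, Set.countable_range q, ?_⟩
    refine Submodule.map_injective_of_injective (f := (J : Quotient (Setoid.ker π) →ₗ[k] H)) hJi ?_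
    rw [Submodule.map_span, ← Set.range_comp, Submodule.map_top]
    have : (J : Quotient (Setoid.ker π) →ₗ[k] H) ∘ q = f := funext hq
    rw [this, hYW]
    ext a
    constructor
    · exact fun ha => hJr a ha
    · rintro ⟨q, rfl⟩
      change J q ∈ W
      rw [hJ]
      exact (e q).2

end SmallHopfOver

section

variable (k : Type u) [Field k] (p : Prop) (B : Type w) [Ring B] [Bialgebra k B]

/-- The transition maps between the small Hopf algebras over a bialgebra. -/
def SmallHopfOver.transition (i j : SmallHopfOver k p B) : Set (i.carrier →ₐc[k] j.carrier) :=
  {h | ∀ a, j.toBase (h a) = i.toBase a}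

/-- The colimit of all the Hopf algebras of countable dimension over a bialgebra. -/
abbrev CofreeHopf : Type (max u w) :=
  HopfColimit (SmallHopfOver.transition k p B)

end

namespace CofreeHopf

variable {k : Type u} [Field k] {p : Prop} {B : Type w} [Ring B] [Bialgebra k B]

theorem bijective_antipode (h : p) :
    Function.Bijective (HopfAlgebra.antipode k (A := CofreeHopf k p B)) :=
  HopfColimit.bijective_antipode fun i => i.bijective_antipode h

variable (k p B) in
/-- The canonical homomorphisms to the colimit. -/
noncomputable abbrev incl (i : SmallHopfOver k p B) : i.carrier →ₐc[k] CofreeHopf k p B :=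
  HopfColimit.incl (SmallHopfOver.transition k p B) i

section

variable {H : Type*} [Ring H] [HopfAlgebra k H]
  (hp : p → Function.Bijective (HopfAlgebra.antipode k (A := H))) (g : H →ₐc[k] B)

include hp in
-- Directedness: the images of countable spanning sets of both pieces lie in a third piece embedded
-- in `H`. Both maps factor through it, and there the two elements coincide.
theorem incl_eq_incl {i i' : SmallHopfOver k p B} (j : i.carrier →ₐc[k] H)
    (j' : i'.carrier →ₐc[k] H) (hj : ∀ a, g (j a) = i.toBase a)
    (hj' : ∀ a, g (j' a) = i'.toBase a) {a : i.carrier} {a' : i'.carrier} (h : j a = j' a') :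
    incl k p B i a = incl k p B i' a' := by
  obtain ⟨Y, hY, hYs⟩ := i.exists_span_eq_top
  obtain ⟨Y', hY', hYs'⟩ := i'.exists_span_eq_top
  obtain ⟨i'', j'', hinj, hsub, hj''⟩ :=
    SmallHopfOver.exists_subset_range hp g ((hY.image j).union (hY'.image j'))
  have key {i : SmallHopfOver k p B} (j : i.carrier →ₐc[k] H) {Y : Set i.carrier}
      (hYs : Submodule.span k Y = ⊤) (h : j '' Y ⊆ Set.range j'') :
      Set.range j ⊆ Set.range j'' := by
    have : Submodule.span k Y ≤ (LinearMap.range (j'' : i''.carrier →ₗ[k] H)).comap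
        (j : i.carrier →ₗ[k] H) :=
      Submodule.span_le.2 fun y hy => h ⟨y, hy, rfl⟩
    rintro _ ⟨a, rfl⟩
    exact this (hYs ▸ Submodule.mem_top)
  obtain ⟨f, hf⟩ := j.exists_factor j'' hinj (key j hYs (Set.subset_union_left.trans hsub))
  obtain ⟨f', hf'⟩ := j'.exists_factor j'' hinj (key j' hYs' (Set.subset_union_right.trans hsub))
  rw [← HopfColimit.incl_comp (h := f) (fun a => by rw [← hj'', hf, hj]) a,
    ← HopfColimit.incl_comp (h := f') (fun a => by rw [← hj'', hf', hj']) a']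
  congr 1
  apply hinj
  rw [hf, hf', h]

include hp in
/-- The canonical homomorphism from a Hopf algebra over `B` to the colimit. -/
theorem exists_bialgHom : ∃ c : H →ₐc[k] CofreeHopf k p B,
    ∀ (i : SmallHopfOver k p B) (j : i.carrier →ₐc[k] H), (∀ a, g (j a) = i.toBase a) →
      ∀ a, c (j a) = incl k p B i a := by
  -- Any two elements lie in a common piece, where sums and products can be compared.
  have hex (h h' : H) : ∃ (i : SmallHopfOver k p B) (j : i.carrier →ₐc[k] H),
      (∀ a, g (j a) = i.toBase a) ∧ (∃ a, j a = h) ∧ ∃ a, j a = h' := by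
    obtain ⟨i, j, _, hsub, hj⟩ := SmallHopfOver.exists_subset_range hp g
      (X := {h, h'}) (Set.to_countable _)
    exact ⟨i, j, hj, hsub (by simp), hsub (by simp)⟩
  choose i₀ j₀ hj₀ hl _ using fun h => hex h h
  choose l hl using hl
  let c : H → CofreeHopf k p B := fun h => incl k p B (i₀ h) (l h)
  have hc {i : SmallHopfOver k p B} (j : i.carrier →ₐc[k] H) (hj : ∀ a, g (j a) = i.toBase a)
      (a : i.carrier) : c (j a) = incl k p B i a :=
    incl_eq_incl hp g _ _ (hj₀ _) hj (hl _)
  let C : H →ₐ[k] CofreeHopf k p B :=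
    { toFun := c
      map_one' := by
        obtain ⟨i, j, hj, -⟩ := hex 1 1
        rw [← map_one j, hc j hj, map_one]
      map_zero' := by
        obtain ⟨i, j, hj, -⟩ := hex 1 1
        rw [← map_zero j, hc j hj, map_zero]
      map_mul' := fun a b => by
        obtain ⟨i, j, hj, ⟨a, rfl⟩, ⟨b, rfl⟩⟩ := hex a b
        rw [← map_mul j, hc j hj, hc j hj, hc j hj, map_mul]
      map_add' := fun a b => by
        obtain ⟨i, j, hj, ⟨a, rfl⟩, ⟨b, rfl⟩⟩ := hex a b
        rw [← map_add j, hc j hj, hc j hj, hc j hj, map_add]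
      commutes' := fun r => by
        obtain ⟨i, j, hj, -⟩ := hex 1 1
        rw [← AlgHomClass.commutes j, hc j hj, AlgHomClass.commutes] }
  refine ⟨.ofAlgHom C ?_ ?_, fun i j hj a => hc j hj a⟩
  · ext h
    obtain ⟨i, j, hj, ⟨a, rfl⟩, -⟩ := hex h h
    change Coalgebra.counit (R := k) (c (j a)) = Coalgebra.counit (R := k) (j a)
    rw [hc j hj, CoalgHomClass.counit_comp_apply, CoalgHomClass.counit_comp_apply]
  · ext h
    obtain ⟨i, j, hj, ⟨a, rfl⟩, -⟩ := hex h h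
    change Algebra.TensorProduct.map C C (comul (j a)) = comul (c (j a))
    rw [hc j hj, ← CoalgHomClass.map_comp_comul_apply, ← CoalgHomClass.map_comp_comul_apply,
      ← (ℛ k a).eq]
    simp only [map_sum, TensorProduct.map_tmul, Algebra.TensorProduct.map_tmul]
    exact Finset.sum_congr rfl fun m _ => congrArg₂ _ (hc j hj _) (hc j hj _)

end

end CofreeHopf

namespace CofreeHopf

variable (k : Type u) [Field k] (p : Prop) (B : Type (max u w)) [Ring B] [Bialgebra k B]

/-- The structure map of the colimit. -/
noncomputable def toBase : CofreeHopf k p B →ₐc[k] B :=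
  HopfColimit.desc (fun i => i.toBase) fun _ _ _ hh a => hh a

variable {k p B}

@[simp]
theorem toBase_incl (i : SmallHopfOver k p B) (a : i.carrier) :
    toBase k p B (incl k p B i a) = i.toBase a :=
  HopfColimit.desc_incl _ _ _ _

/-- For uniqueness, the canonical map `c₀` of the colimit to itself is the identity. If `f` lies
over `B`, then `f ∘ j` maps a small piece to the colimit over `B`, so `c₀` sends `f (j a)` to the
canonical image of `a`. -/
theorem existsUnique_bialgHom {H : Type*} [Ring H] [HopfAlgebra k H]
    (hp : p → Function.Bijective (HopfAlgebra.antipode k (A := H))) (g : H →ₐc[k] B) :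
    ∃! f : H →ₐc[k] CofreeHopf k p B, ∀ h, toBase k p B (f h) = g h := by
  obtain ⟨c, hc⟩ := exists_bialgHom hp g
  obtain ⟨c₀, hc₀⟩ := exists_bialgHom (k := k) (p := p) bijective_antipode (toBase k p B)
  have h₀ : c₀ = BialgHom.id k _ :=
    HopfColimit.bialgHom_ext fun i a => hc₀ i (incl k p B i) (fun a => toBase_incl i a) a
  have hex (h : H) : ∃ (i : SmallHopfOver k p B) (j : i.carrier →ₐc[k] H) (a : i.carrier),
      j a = h ∧ ∀ a, g (j a) = i.toBase a := by
    obtain ⟨i, j, _, hsub, hj⟩ := SmallHopfOver.exists_subset_range hp g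
      (X := {h}) (Set.to_countable _)
    obtain ⟨a, ha⟩ := hsub rfl
    exact ⟨i, j, a, ha, hj⟩
  refine ⟨c, fun h => ?_, fun f hf => BialgHom.ext fun h => ?_⟩
  · obtain ⟨i, j, a, rfl, hj⟩ := hex h
    rw [hc i j hj, toBase_incl, hj]
  · obtain ⟨i, j, a, rfl, hj⟩ := hex h
    have := hc₀ i (f.comp j) (fun a => by rw [← hj, BialgHom.comp_apply, hf]) a
    rw [h₀] at this
    rw [hc i j hj]
    exact this

end CofreeHopf
end CofreeHopf

/-! ### Adjoints from universal arrows -/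

section Adjoints

variable {C D : Type*} [Category C] [Category D]

/-- Universal arrows are initial objects of the comma categories. The unit of any adjunction factors
the given epimorphism `η`, and `η` factors the unit, so cancellability carries over. -/
theorem isRightAdjoint_and_epi_unit {R : D ⥤ C}
    (h : ∀ B : C, ∃ (X : D) (η : B ⟶ R.obj X), Epi η ∧
      ∀ (Y : D) (f : B ⟶ R.obj Y), ∃! g : X ⟶ Y, η ≫ R.map g = f) :
    R.IsRightAdjoint ∧ ∀ (L : C ⥤ D) (adj : L ⊣ R) (B : C), Epi (adj.unit.app B) := by
  constructor
  · have (B : C) : Limits.HasInitial (StructuredArrow B R) := by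
      obtain ⟨X, η, -, hX⟩ := h B
      choose g hg hg' using hX
      exact (Limits.IsInitial.ofUniqueHom (X := StructuredArrow.mk η)
        (fun Z => StructuredArrow.homMk (g Z.right Z.hom) (hg Z.right Z.hom))
        (fun Z m => StructuredArrow.ext _ _
          (hg' Z.right Z.hom _ (StructuredArrow.w m)))).hasInitial
    exact isRightAdjointOfStructuredArrowInitials R
  · intro L adj B
    obtain ⟨X, η, hη, hX⟩ := h B
    obtain ⟨g, hg, -⟩ := hX _ (adj.unit.app B)
    let a : L.obj B ⟶ X := (adj.homEquiv B X).symm η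
    have ha : adj.unit.app B ≫ R.map a = η :=
      (adj.homEquiv_unit _ _ _).symm.trans ((adj.homEquiv B X).apply_symm_apply η)
    have hag : a ≫ g = 𝟙 _ := (adj.homEquiv B _).injective (by
      rw [adj.homEquiv_unit, adj.homEquiv_unit, R.map_comp, reassoc_of% ha, hg]; simp)
    refine ⟨fun {Z} s t hst => ?_⟩
    have h₁ : R.map g ≫ s = R.map g ≫ t := by
      rw [← cancel_epi η, reassoc_of% hg, reassoc_of% hg, hst]
    have h₂ : R.map a ≫ R.map g = 𝟙 _ := by rw [← R.map_comp, hag, R.map_id]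
    simpa [reassoc_of% h₂] using congr(R.map a ≫ $h₁)

theorem isLeftAdjoint_of_existsUnique {F : D ⥤ C}
    (h : ∀ B : C, ∃ (X : D) (ε : F.obj X ⟶ B),
      ∀ (Y : D) (f : F.obj Y ⟶ B), ∃! g : Y ⟶ X, F.map g ≫ ε = f) :
    F.IsLeftAdjoint := by
  have (B : C) : Limits.HasTerminal (CostructuredArrow F B) := by
    obtain ⟨X, ε, hX⟩ := h B
    choose g hg hg' using hX
    exact (Limits.IsTerminal.ofUniqueHom (Y := CostructuredArrow.mk ε)
      (fun Z => CostructuredArrow.homMk (g Z.left Z.hom) (hg Z.left Z.hom))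
      (fun Z m => CostructuredArrow.ext _ _
        (hg' Z.left Z.hom _ (CostructuredArrow.w m)))).hasTerminal
  exact isLeftAdjoint_of_costructuredArrowTerminals F

/-- Two maps `Z ⟶ F (G B)` correspond to maps `L Z ⟶ G B`. If they agree after the counit,
cancelling the unit at `Z` shows that the transposes of the latter under `F ⊣ G` agree. -/
theorem mono_counit_of_epi_unit {F : D ⥤ C} {L G : C ⥤ D} (adj : L ⊣ F)
    (hepi : ∀ B, Epi (adj.unit.app B)) (adj' : F ⊣ G) (B : C) : Mono (adj'.counit.app B) where
  right_cancellation {Z} f g hfg := by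
    obtain ⟨f, rfl⟩ := (adj.homEquiv _ _).surjective f
    obtain ⟨g, rfl⟩ := (adj.homEquiv _ _).surjective g
    have := hepi Z
    rw [adj.homEquiv_unit, adj.homEquiv_unit, Category.assoc, Category.assoc, cancel_epi] at hfg
    congr 1
    apply (adj'.homEquiv _ _).symm.injective
    rw [adj'.homEquiv_counit, adj'.homEquiv_counit, hfg]

end Adjoints

/-! ### Free objects: towers indexed by `ℕ` and by `ℤ` -/

section FreeHopf

instance : AntipodeTower.Based Nat.succ where
  base := 0
  generates P h₀ h n := by
    induction n with
    | zero => exact h₀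
    | succ n ih => exact (h n).1 ih

instance : AntipodeTower.Based (fun m : ℤ => m + 1) where
  base := 0
  generates P h₀ h n := by
    induction n with
    | zero => exact h₀
    | succ n ih => exact (h n).1 ih
    | pred n ih => exact (h _).2 (by simpa using ih)

/-- The square of the antipode. -/
noncomputable def HopfAlgebra.antipodeSq (k : Type*) [CommRing k] (L : Type*) [Ring L]
    [HopfAlgebra k L] : L →ₐ[k] L :=
  (AlgEquiv.opOp k L).symm.toAlgHom.comp
    ((AlgHom.op (HopfAlgebra.antipodeAlgHomOp k L)).comp (HopfAlgebra.antipodeAlgHomOp k L))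

namespace TowerAlgebra

variable {k : Type u} [CommRing k] {B : Type w} [Ring B] [Bialgebra k B]

theorem bialgHom_ext {I : Type} {σ : I → I} [AntipodeTower.Based σ] {L : Type*} [Ring L]
    [Bialgebra k L] {F G : TowerAlgebra k σ B →ₐc[k] L}
    (h : F.comp (unit k σ B) = G.comp (unit k σ B)) : F = G := by
  have : (F : TowerAlgebra k σ B →ₐ[k] L) = G := hom_ext' fun b => congr($h b)
  exact BialgHom.ext fun a => congr($this a)

theorem existsUnique_of_exists {I : Type} {σ : I → I} [AntipodeTower.Based σ] {L : Type*} [Ring L]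
    [Bialgebra k L] {f : B →ₐc[k] L}
    (h : ∃ F : TowerAlgebra k σ B →ₐc[k] L, F.comp (unit k σ B) = f) :
    ∃! F : TowerAlgebra k σ B →ₐc[k] L, F.comp (unit k σ B) = f := by
  obtain ⟨F, rfl⟩ := h
  exact ⟨F, rfl, fun G hG => bialgHom_ext hG⟩

theorem existsUnique_nat {L : Type (max u w)} [Ring L] [HopfAlgebra k L] (f : B →ₐc[k] L) :
    ∃! F : TowerAlgebra k Nat.succ B →ₐc[k] L, F.comp (unit k Nat.succ B) = f := by
  refine existsUnique_of_exists (exists_bialgHom f (fun m => HopfAlgebra.antipodeSq k L ^ m)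
    (fun a => rfl) (fun m a => ?_) (fun m a => ?_))
  · rw [Nat.succ_eq_add_one, pow_succ']
    rfl
  · induction m with
    | zero => rfl
    | succ m ih =>
      rw [pow_succ', AlgHom.mul_apply, AlgHom.mul_apply, ih]
      rfl

theorem existsUnique_int {L : Type (max u w)} [Ring L] [HopfAlgebra k L]
    (hS : Function.Bijective (HopfAlgebra.antipode k (A := L))) (f : B →ₐc[k] L) :
    ∃! F : TowerAlgebra k (fun m : ℤ => m + 1) B →ₐc[k] L, F.comp (unit k _ B) = f := by
  -- With a bijective antipode `S²` is an automorphism, so its integer powers supply the negative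
  -- part of the tower.
  let E : L ≃ₐ[k] L := AlgEquiv.ofBijective (HopfAlgebra.antipodeSq k L) (hS.comp hS)
  have hE (a : L) : E a = HopfAlgebra.antipode k (HopfAlgebra.antipode k a) := rfl
  have hE' (a : L) : E⁻¹ (HopfAlgebra.antipode k a) = HopfAlgebra.antipode k (E⁻¹ a) := by
    obtain ⟨a, rfl⟩ := E.surjective a
    change E.symm _ = HopfAlgebra.antipode k (E.symm (E a))
    rw [E.symm_apply_apply, E.symm_apply_eq]
    rfl
  refine existsUnique_of_exists (exists_bialgHom f (fun m => ((E ^ m : L ≃ₐ[k] L) : L →ₐ[k] L))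
    (fun a => rfl) (fun m a => ?_) (fun m a => ?_))
  · change (E ^ (m + 1)) a = E ((E ^ m) a)
    rw [add_comm, zpow_add, zpow_one]
    rfl
  · change (E ^ m) _ = HopfAlgebra.antipode k ((E ^ m) a)
    induction m with
    | zero => rfl
    | succ m ih =>
      rw [add_comm, zpow_add, zpow_one, AlgEquiv.mul_apply, AlgEquiv.mul_apply, ih]
      rfl
    | pred m ih =>
      rw [sub_eq_neg_add, zpow_add, zpow_neg_one, AlgEquiv.mul_apply, AlgEquiv.mul_apply, ih, hE']

end TowerAlgebra
end FreeHopf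

/-! ### The four adjoints and the theorem -/

theorem isRightAdjoint_hopfToBialg (k : Type u) [Field k] :
    (hopfToBialg.{max u v} k).IsRightAdjoint ∧
      ∀ (L : BialgCat.{max u v} k ⥤ HopfAlgCat.{max u v} k)
        (adj : L ⊣ hopfToBialg.{max u v} k) (B : BialgCat.{max u v} k),
        Epi (adj.unit.app B) := by
  refine isRightAdjoint_and_epi_unit fun B => ?_
  refine ⟨HopfAlgCat.of k (TowerAlgebra k Nat.succ B),
    BialgCat.ofHom (TowerAlgebra.unit k Nat.succ B), ⟨fun {Z} s t hst => ?_⟩, fun Y f => ?_⟩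
  · exact BialgCat.hom_ext _ _
      (TowerAlgebra.bialgHom_ext congr(($hst).toBialgHom))
  · obtain ⟨F, hF, hF'⟩ := TowerAlgebra.existsUnique_nat (L := Y) f.toBialgHom
    exact ⟨HopfAlgCat.ofHom F, BialgCat.hom_ext _ _ hF,
      fun G hG => HopfAlgCat.hom_ext _ _ (hF' G.toBialgHom congr(($hG).toBialgHom))⟩

theorem isRightAdjoint_sHopfToHopf (k : Type u) [Field k] :
    (sHopfToHopf.{max u v} k).IsRightAdjoint ∧
      ∀ (L : HopfAlgCat.{max u v} k ⥤ SHopfAlgCat.{max u v} k)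
        (adj : L ⊣ sHopfToHopf.{max u v} k) (H : HopfAlgCat.{max u v} k),
        Epi (adj.unit.app H) := by
  refine isRightAdjoint_and_epi_unit fun B => ?_
  refine ⟨⟨HopfAlgCat.of k (TowerAlgebra k (fun m : ℤ => m + 1) B),
    TowerAlgebra.bijective_antipode (fun m => m - 1) (by simp) (by simp)⟩,
    HopfAlgCat.ofHom (TowerAlgebra.unit k _ B), ⟨fun {Z} s t hst => ?_⟩, fun Y f => ?_⟩
  · exact HopfAlgCat.hom_ext _ _
      (TowerAlgebra.bialgHom_ext congr(($hst).toBialgHom))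
  · obtain ⟨F, hF, hF'⟩ := TowerAlgebra.existsUnique_int (L := Y.obj) Y.property f.toBialgHom
    exact ⟨ObjectProperty.homMk (HopfAlgCat.ofHom F), HopfAlgCat.hom_ext _ _ hF,
      fun G hG => ObjectProperty.hom_ext _
        (HopfAlgCat.hom_ext _ _ (hF' G.hom.toBialgHom congr(($hG).toBialgHom)))⟩

theorem isLeftAdjoint_hopfToBialg (k : Type u) [Field k] :
    (hopfToBialg.{max u v} k).IsLeftAdjoint := by
  refine isLeftAdjoint_of_existsUnique fun B => ?_
  refine ⟨HopfAlgCat.of k (CofreeHopf k False B), BialgCat.ofHom (CofreeHopf.toBase k False B),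
    fun Y f => ?_⟩
  obtain ⟨F, hF, hF'⟩ := CofreeHopf.existsUnique_bialgHom (p := False) (H := Y) (fun h => h.elim)
    f.toBialgHom
  exact ⟨HopfAlgCat.ofHom F, BialgCat.hom_ext _ _ (BialgHom.ext hF),
    fun G hG => HopfAlgCat.hom_ext _ _ (hF' G.toBialgHom fun h => congr(($hG).toBialgHom h))⟩

theorem isLeftAdjoint_sHopfToHopf (k : Type u) [Field k] :
    (sHopfToHopf.{max u v} k).IsLeftAdjoint := by
  refine isLeftAdjoint_of_existsUnique fun B => ?_
  refine ⟨⟨HopfAlgCat.of k (CofreeHopf k True B), CofreeHopf.bijective_antipode trivial⟩,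
    HopfAlgCat.ofHom (CofreeHopf.toBase k True B), fun Y f => ?_⟩
  obtain ⟨F, hF, hF'⟩ := CofreeHopf.existsUnique_bialgHom (p := True) (H := Y.obj)
    (fun _ => Y.property) f.toBialgHom
  exact ⟨ObjectProperty.homMk (HopfAlgCat.ofHom F), HopfAlgCat.hom_ext _ _ (BialgHom.ext hF),
    fun G hG => ObjectProperty.hom_ext _ (HopfAlgCat.hom_ext _ _
      (hF' G.hom.toBialgHom fun h => congr(($hG).toBialgHom h)))⟩

theorem mainTheorem1 (k : Type u) [Field k] :
    -- (a) the inclusion of Hopf algebras into bialgebras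
    (((hopfToBialg.{max u v} k).IsRightAdjoint ∧
        ∀ (Hfree : BialgCat.{max u v} k ⥤ HopfAlgCat.{max u v} k)
          (adj : Hfree ⊣ hopfToBialg.{max u v} k) (B : BialgCat.{max u v} k),
          Epi (adj.unit.app B)) ∧
      ((hopfToBialg.{max u v} k).IsLeftAdjoint ∧
        ∀ (Hcofree : BialgCat.{max u v} k ⥤ HopfAlgCat.{max u v} k)
          (adj : hopfToBialg.{max u v} k ⊣ Hcofree) (B : BialgCat.{max u v} k),
          Mono (adj.counit.app B))) ∧
    -- (b) the inclusion of Hopf algebras with bijective antipode into Hopf algebras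
    (((sHopfToHopf.{max u v} k).IsRightAdjoint ∧
        ∀ (Kfree : HopfAlgCat.{max u v} k ⥤ SHopfAlgCat.{max u v} k)
          (adj : Kfree ⊣ sHopfToHopf.{max u v} k) (H : HopfAlgCat.{max u v} k),
          Epi (adj.unit.app H)) ∧
      ((sHopfToHopf.{max u v} k).IsLeftAdjoint ∧
        ∀ (Kcofree : HopfAlgCat.{max u v} k ⥤ SHopfAlgCat.{max u v} k)
          (adj : sHopfToHopf.{max u v} k ⊣ Kcofree) (H : HopfAlgCat.{max u v} k),
          Mono (adj.counit.app H))) := by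
  obtain ⟨hj, hj'⟩ := isRightAdjoint_hopfToBialg.{u, v} k
  obtain ⟨hi, hi'⟩ := isRightAdjoint_sHopfToHopf.{u, v} k
  exact ⟨⟨⟨hj, hj'⟩, isLeftAdjoint_hopfToBialg k, fun G adj B =>
      mono_counit_of_epi_unit (.ofIsRightAdjoint _) (hj' _ _) adj B⟩,
    ⟨hi, hi'⟩, isLeftAdjoint_sHopfToHopf k, fun G adj H =>
      mono_counit_of_epi_unit (.ofIsRightAdjoint _) (hi' _ _) adj H⟩
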